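/- **Setting.** Let $n,d,g,M\ge 1$ be integers ($n$ = sequence length, $d$ = feature dimension, $g$ = degree of the approximating polynomial, $M$ = capacity of the fast memory) and $r=\binom{d+g}{g}$. Approximate Attention is the computation of $U_1(U_2^{\top}V)$ from $Q,K,V\in\mathbb R^{n\times d}$, where the columns of $U_1,U_2\in\mathbb R^{n\times r}$ are indexed by the $r$ monomials of degree at most $g$ in $d$ variables, and the entry of $U_1$ (of $U_2$) in row $i$ and column $e$ is the monomial $e$ evaluated at the $i$-th row of $Q$ (of $K$). Its computational DAG has one node for each entry of $Q,K,V,U_1,U_2$, of $H=U_2^{\top}V$ and of the output $U_1H$, and one node for each scalar product $(U_2)_{ie}V_{ik}$ and $(U_1)_{ie}H_{ek}$; a node of $U_1$ ($U_2$) has as parents the entries in its row of $Q$ ($K$) that occur in its monomial, a product has its two factors as parents, and an entry of $H$ or of the output has as parents the products of which it is the sum. I/O cost is measured in the red-blue pebble game with partial computations: initially the sources are in slow memory (which is unbounded), fast memory is empty and may hold at most $M$ (partial or final) node values at any time; a step may load a value from slow memory, save a value to slow memory, delete a value from fast memory, or aggregate into a node $v$ in fast memory (started from scratch if no value of $v$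 is in fast memory) one further parent $u$ whose final value is in fast memory. Recomputation is allowed. The game ends when the final values of all sinks are in slow memory. The cost is the number of loads and saves; the optimal I/O cost is the minimum over all such executions. **Theorem 3 (Case III).** Let $n,d,g,M$ vary so that $M=o(d\cdot r)$, $g=\Omega(\log M)$ and $g=o(\sqrt M)$. Then the optimal I/O cost of Approximate Attention is $$O\!\left(\min\!\left(\frac{n\cdot r\cdot d^2}{M},\ \frac{n\cdot r\cdot d}{\sqrt M}\right)\right).$$ If $d\ge 5g$ and $n\ge r$, then it is also $$\Omega\!\left(\frac{n\cdot r\cdot d\cdot g}{M}\right).$$ Moreover, if $d\ge 5g$, then the monomials that contain at least $g/2$ different variables make up at least a constant fraction of the $r$ columns, and if also $n\ge r$, the lower bound $\Omega(n\cdot r\cdot d\cdot g/M)$ already holds for the optimal I/O cost of the computation restricted to these columns of $U_1$ and $U_2$. All implied constants are absolute. -/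

import Mathlib

open Filter Asymptotics
open scoped ENNReal

/-! ### The red-blue pebble game with partial computations -/

namespace Pebbling

variable {V : Type*}

/-- Contents of the two memories while a computational DAG on the node set `V` is executed.
`fast v = some S` means that there is a red pebble on `v`, and that the value of `v` held in fast
memory is the one aggregated so far from exactly the parents in `S`; `none` means that there is no
red pebble on `v`. In the same way, `slow` describes the blue pebbles. -/
structure Config (V : Type*) where
  fast : V → Option (Set V)
  slow : V → Option (Set V)

/-- The set `S` contains all parents of `v`, so the value of `v` aggregated from `S` is final. -/
def IsFinal (G : Digraph V) (v : V) (S : Set V) : Prop :=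
  ∀ u, G.Adj u v → u ∈ S

/-- The number of red pebbles. -/
noncomputable def Config.redCount (c : Config V) : ℕ∞ :=
  {v | c.fast v ≠ none}.encard

open Classical in
/-- One step of the game together with its I/O cost. Loads and saves cost `1`; computing and
deleting is free. A (partial) computation aggregates one further parent `u`, whose final value is in
fast memory, into `v`; if there is no red pebble on `v`, the aggregation is started from scratch, so
values may be recomputed. Sources have no parents and can only be loaded. -/
inductive Step (G : Digraph V) : Config V → Config V → ℕ → Prop
  | load (c : Config V) (v : V) (S : Set V) (h : c.slow v = some S) :
      Step G c ⟨Function.update c.fast v (some S), c.slow⟩ 1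
  | save (c : Config V) (v : V) (S : Set V) (h : c.fast v = some S) :
      Step G c ⟨c.fast, Function.update c.slow v (some S)⟩ 1
  | delete (c : Config V) (v : V) :
      Step G c ⟨Function.update c.fast v none, c.slow⟩ 0
  | compute (c : Config V) (u v : V) (S : Set V) (huv : G.Adj u v)
      (hu : c.fast u = some S) (hS : IsFinal G u S) (hv : u ∉ (c.fast v).getD ∅) :
      Step G c ⟨Function.update c.fast v (some (insert u ((c.fast v).getD ∅))), c.slow⟩ 0

/-- `Run G M c c' k`: a sequence of steps leads from `c` to `c'`, has total I/O cost `k`, and at no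
time after a step are there more than `M` red pebbles. -/
inductive Run (G : Digraph V) (M : ℕ) : Config V → Config V → ℕ → Prop
  | refl (c : Config V) : Run G M c c 0
  | tail {c c' c'' : Config V} {k l : ℕ} (hrun : Run G M c c' k) (hstep : Step G c' c'' l)
      (hcap : c''.redCount ≤ M) : Run G M c c'' (k + l)

open Classical in
/-- Initially the fast memory is empty, and exactly the sources carry a blue pebble. -/
noncomputable def start (G : Digraph V) : Config V where
  fast := fun _ => none
  slow := fun v => if ∀ u, ¬ G.Adj u v then some ∅ else none

/-- The game is finished when the final values of all sinks are in slow memory. -/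
def IsFinished (G : Digraph V) (c : Config V) : Prop :=
  ∀ v, (∀ w, ¬ G.Adj v w) → ∃ S, c.slow v = some S ∧ IsFinal G v S

/-- The optimal I/O cost of the computation `G` with a fast memory of capacity `M`
(it is `⊤` if the computation cannot be executed at all). -/
noncomputable def optimalCost (G : Digraph V) (M : ℕ) : ℕ∞ :=
  ⨅ (k : ℕ) (_ : ∃ c, Run G M (start G) c k ∧ IsFinished G c), (k : ℕ∞)

end Pebbling

/-! ### The computational DAG of approximate attention -/

namespace ApproxAttention

/-- The monomials of degree at most `g` in `d` variables, as exponent vectors. They index the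
columns of `U₁` and `U₂`. -/
def monomials (d g : ℕ) : Set (Fin d → ℕ) :=
  {e | ∑ k, e k ≤ g}

/-- The monomials of degree at most `g` in `d` variables that contain at least `g / 2` different
variables. -/
def richMonomials (d g : ℕ) : Set (Fin d → ℕ) :=
  {e ∈ monomials d g | (g : ℝ) / 2 ≤ (Finset.univ.filter fun k => e k ≠ 0).card}

/-- The nodes of the computation of `U₁ (U₂ᵀ V)`, where `Q`, `K`, `V` are `n × d` matrices and the
columns of `U₁` and `U₂` are indexed by the monomials in `J`. -/
inductive Node (n d : ℕ) (J : Set (Fin d → ℕ)) : Type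
  /-- entries of the input matrices -/
  | Q (i : Fin n) (k : Fin d)
  | K (i : Fin n) (k : Fin d)
  | V (i : Fin n) (k : Fin d)
  /-- entries of `U₁`, `U₂`: the monomial `e` evaluated at the `i`-th row of `Q`, `K` -/
  | U₁ (i : Fin n) (e : J)
  | U₂ (i : Fin n) (e : J)
  /-- the product of the entries `(i, e)` of `U₂` and `(i, k)` of `V` -/
  | prodH (i : Fin n) (e : J) (k : Fin d)
  /-- entries of `H = U₂ᵀ V` -/
  | H (e : J) (k : Fin d)
  /-- the product of the entries `(i, e)` of `U₁` and `(e, k)` of `H` -/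
  | prodO (i : Fin n) (e : J) (k : Fin d)
  /-- entries of the output `U₁ H` -/
  | O (i : Fin n) (k : Fin d)

/-- The data dependencies. An entry of `U₁` (of `U₂`) depends on those entries in the same row of
`Q` (of `K`) that occur in its monomial. -/
inductive Edge (n d : ℕ) (J : Set (Fin d → ℕ)) : Node n d J → Node n d J → Prop
  | Q_U₁ (i : Fin n) (k : Fin d) (e : J) (h : e.1 k ≠ 0) : Edge n d J (.Q i k) (.U₁ i e)
  | K_U₂ (i : Fin n) (k : Fin d) (e : J) (h : e.1 k ≠ 0) : Edge n d J (.K i k) (.U₂ i e)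
  | U₂_prodH (i : Fin n) (e : J) (k : Fin d) : Edge n d J (.U₂ i e) (.prodH i e k)
  | V_prodH (i : Fin n) (e : J) (k : Fin d) : Edge n d J (.V i k) (.prodH i e k)
  | prodH_H (i : Fin n) (e : J) (k : Fin d) : Edge n d J (.prodH i e k) (.H e k)
  | U₁_prodO (i : Fin n) (e : J) (k : Fin d) : Edge n d J (.U₁ i e) (.prodO i e k)
  | H_prodO (i : Fin n) (e : J) (k : Fin d) : Edge n d J (.H e k) (.prodO i e k)
  | prodO_O (i : Fin n) (e : J) (k : Fin d) : Edge n d J (.prodO i e k) (.O i k)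

/-- The computational DAG of `U₁ (U₂ᵀ V)` with columns of `U₁`, `U₂` indexed by `J`. -/
def dag (n d : ℕ) (J : Set (Fin d → ℕ)) : Digraph (Node n d J) where
  Adj := Edge n d J

/-- The optimal I/O cost of approximate attention for sequence length `n`, feature dimension `d`,
degree `g` and fast memory capacity `M`. -/
noncomputable def cost (n d g M : ℕ) : ℕ∞ :=
  Pebbling.optimalCost (dag n d (monomials d g)) M

/-- The optimal I/O cost of the part of the computation that belongs to the columns of `U₁`, `U₂`
whose monomials contain at least `g / 2` different variables. -/
noncomputable def richCost (n d g M : ℕ) : ℕ∞ :=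
  Pebbling.optimalCost (dag n d (richMonomials d g)) M

/-- The number of columns of `U₁` and `U₂`. -/
def rank (d g : ℕ) : ℕ := (d + g).choose g

end ApproxAttention

/-! Counting. Exactly `g.choose s.card` monomials of degree at most `g` have support `s`, so `r` is
the sum of `d.choose j * g.choose j`. For `2 * g ≤ d` the reflection `j ↦ g - j` shows that the
terms with `j ≥ g / 2` carry at least half of it (`rank_le_two_mul_ncard_richMonomials`).

Lower bound. Fix the set `R` of rich columns and cut an execution into segments of at most `M` loads
and saves. Within a segment, at most `m = 2M` nodes are red at the beginning or loaded (`L`), and at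
most `m` are saved or red at the end (`D`). `Trace.card_prodO_le` bounds the products `U₁ i e * H e
k` that a segment can add to outputs in `D`: (a) at most `m` products lie in `L` themselves; (b) if
`U₁ i e` lies in `L`, Loomis–Whitney applies to the triples `(i, e, k)`: their projections are
entries of `U₁` in `L`, available entries of `H`, and outputs in `D`; (c) otherwise `U₁ i e` was
computed, so at least `g / 2` entries of row `i` of `Q` lie in `L`; there are at most `2m / g` such
rows, each paired with the available entries of `H`. At most `3m` entries of `H` in rich columns
become available: one that is obtained without loading itself or one of its products requires a
whole column of `V`, that is `n ≥ R.card` entries. As `g ^ 2 ≤ M`, a segment contributes `O(M ^ 2 /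
g)` of the at least `n * d * r / 2` products. The incomplete last segment is absorbed when `M ≤ r *
g`; when `r * g ≤ M`, saving the `n * d` outputs is already expensive enough. Recomputation and
partial values are covered by the potential `progress`.

Upper bound. Split `H` into tiles. A tile stays in fast memory while the rows of `K` and `V` are
streamed to build it, and then the rows of `Q` and of the output to use it up, so `H` is never
saved. If `d ^ 2 ≤ M`, tiles have full width `d` and about `M / d` columns of `U₁`, `U₂`, whose
entries are recomputed from the current row (`cost_le_of_sq_le`). If `M ≤ d ^ 2`, all of `U₁`, `U₂`
is precomputed and saved, and tiles are squares of side about `√M / 2` (`cost_le_of_lt_sq`). -/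

namespace ApproxAttention

/-! ### Counting monomials by their support -/

/-- The monomials of degree at most `g` whose variables are exactly those in `s`. -/
def monomialsWithSupport {d : ℕ} (g : ℕ) (s : Finset (Fin d)) : Set (Fin d → ℕ) :=
  {e ∈ monomials d g | ∀ k, e k ≠ 0 ↔ k ∈ s}

theorem finite_monomials (d g : ℕ) : (monomials d g).Finite := by
  refine (Set.finite_Iic (fun _ : Fin d => g)).subset fun e he k => ?_
  exact (Finset.single_le_sum (f := e) (fun _ _ => Nat.zero_le _) (Finset.mem_univ k)).trans he

theorem finite_monomialsWithSupport {d : ℕ} (g : ℕ) (s : Finset (Fin d)) :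
    (monomialsWithSupport g s).Finite :=
  (finite_monomials d g).subset fun _ h => h.1

theorem sum_add_single {d : ℕ} (e : Fin d → ℕ) (a : Fin d) :
    ∑ k, (e + Pi.single a 1 : Fin d → ℕ) k = ∑ k, e k + 1 := by
  simp [Finset.sum_add_distrib]

/-- Lowering the exponent of `a` by one leaves the support unchanged if the exponent was at least
two, and removes `a` if it was one. For cardinalities this is Pascal's rule. -/
theorem monomialsWithSupport_insert_succ {d : ℕ} (g : ℕ) {s : Finset (Fin d)} {a : Fin d}
    (ha : a ∉ s) :
    monomialsWithSupport (g + 1) (insert a s) =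
      (fun e => e + Pi.single a 1) ''
        (monomialsWithSupport g (insert a s) ∪ monomialsWithSupport g s) := by
  ext e
  constructor
  · rintro ⟨he, hs⟩
    have hea : e a ≠ 0 := (hs a).2 (Finset.mem_insert_self _ _)
    have heq : Function.update e a (e a - 1) + Pi.single a 1 = e := by
      funext k
      by_cases hk : k = a
      · subst hk; simp; omega
      · simp [hk]
    refine ⟨Function.update e a (e a - 1), ?_, heq⟩
    have hdeg : Function.update e a (e a - 1) ∈ monomials d g := by
      have := sum_add_single (Function.update e a (e a - 1)) a
      rw [heq] at this
      have he' : ∑ k, e k ≤ g + 1 := he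
      show ∑ k, Function.update e a (e a - 1) k ≤ g
      omega
    by_cases h1 : e a = 1
    · right
      refine ⟨hdeg, fun k => ?_⟩
      by_cases hk : k = a
      · subst hk; simp [h1, ha]
      · simpa [hk] using hs k
    · left
      refine ⟨hdeg, fun k => ?_⟩
      by_cases hk : k = a
      · subst hk; simp; omega
      · simpa [hk] using hs k
  · rintro ⟨e, he, rfl⟩
    refine ⟨?_, fun k => ?_⟩
    · have h : ∑ k, e k ≤ g := by rcases he with he | he <;> exact he.1
      show ∑ k, (e + Pi.single a 1 : Fin d → ℕ) k ≤ g + 1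
      rw [sum_add_single]; omega
    · by_cases hk : k = a
      · subst hk; simp
      · rcases he with he | he <;> simpa [hk] using he.2 k

theorem ncard_monomialsWithSupport {d : ℕ} (s : Finset (Fin d)) (g : ℕ) :
    (monomialsWithSupport g s).ncard = g.choose s.card := by
  induction s using Finset.induction_on generalizing g with
  | empty =>
    have : monomialsWithSupport g (∅ : Finset (Fin d)) = {0} := by
      ext e
      constructor
      · rintro ⟨-, h⟩
        funext k
        simpa using h k
      · rintro rfl
        exact ⟨by simp [monomials], by simp⟩
    simp [this]
  | insert a s ha ih =>
    induction g with
    | zero =>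
      have : monomialsWithSupport 0 (insert a s) = ∅ := by
        ext e
        simp only [Set.mem_empty_iff_false, iff_false]
        rintro ⟨h0, h⟩
        have h0' : ∑ k, e k ≤ 0 := h0
        have := (h a).2 (Finset.mem_insert_self _ _)
        have := Finset.single_le_sum (f := e) (fun _ _ => Nat.zero_le _) (Finset.mem_univ a)
        omega
      simp [this, Finset.card_insert_of_notMem ha]
    | succ g ihg =>
      rw [monomialsWithSupport_insert_succ g ha,
        Set.ncard_image_of_injective _ (add_left_injective _),
        Set.ncard_union_eq _ (finite_monomialsWithSupport _ _) (finite_monomialsWithSupport _ _),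
        ihg, ih, Finset.card_insert_of_notMem ha, Nat.choose_succ_succ, add_comm]
      rw [Set.disjoint_left]
      rintro e ⟨-, h1⟩ ⟨-, h2⟩
      exact ha ((h2 a).1 ((h1 a).2 (Finset.mem_insert_self _ _)))

/-- Monomials are grouped by support, and supports by cardinality. -/
theorem ncard_filter_support (d g : ℕ) (p : ℕ → Prop) [DecidablePred p] :
    {e ∈ monomials d g | p (Finset.univ.filter fun k => e k ≠ 0).card}.ncard =
      ∑ j ∈ (Finset.range (d + 1)).filter p, d.choose j * g.choose j := by
  classical
  have hfin : {e ∈ monomials d g | p (Finset.univ.filter fun k => e k ≠ 0).card}.Finite :=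
    (finite_monomials d g).subset fun _ h => h.1
  rw [Set.ncard_eq_toFinset_card _ hfin,
    Finset.card_eq_sum_card_fiberwise (f := fun e : Fin d → ℕ => Finset.univ.filter fun k => e k ≠ 0)
      (t := Finset.univ.filter fun s : Finset (Fin d) => p s.card)]
  · have h1 : ∀ s ∈ Finset.univ.filter (fun s : Finset (Fin d) => p s.card),
        (hfin.toFinset.filter fun e => (Finset.univ.filter fun k => e k ≠ 0) = s).card =
          g.choose s.card := by
      intro s hs
      rw [← ncard_monomialsWithSupport s g, ← Set.ncard_coe_finset]
      congr 1
      ext e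
      simp only [Finset.coe_filter, Set.Finite.mem_toFinset, Set.mem_ofPred_eq, monomialsWithSupport]
      constructor
      · rintro ⟨⟨h, -⟩, rfl⟩
        exact ⟨h, by simp⟩
      · rintro ⟨h, h'⟩
        have : (Finset.univ.filter fun k => e k ≠ 0) = s := by
          ext k; simpa using h' k
        exact ⟨⟨h, by rw [this]; simpa using hs⟩, this⟩
    rw [Finset.sum_congr rfl h1, Finset.sum_filter, ← Finset.powerset_univ,
      Finset.sum_powerset_apply_card (fun j => if p j then g.choose j else 0), Finset.sum_filter]
    simp only [Finset.card_univ, Fintype.card_fin, smul_eq_mul, mul_ite, mul_zero]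
  · intro e he
    simpa using ((Set.Finite.mem_toFinset hfin).1 he).2

/-- Vandermonde's identity, with `g - j` replaced by `j` in the second factor. -/
theorem rank_eq_sum (d g : ℕ) :
    rank d g = ∑ j ∈ Finset.range (g + 1), d.choose j * g.choose j := by
  rw [rank, Nat.add_choose_eq, Finset.Nat.sum_antidiagonal_eq_sum_range_succ_mk]
  refine Finset.sum_congr rfl fun j hj => ?_
  rw [Nat.choose_symm (by simp at hj; omega)]

theorem ncard_monomials (d g : ℕ) : (monomials d g).ncard = rank d g := by
  have h := ncard_filter_support d g (fun _ => True)
  simp only [and_true, Finset.filter_true] at h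
  rw [show {e | e ∈ monomials d g} = monomials d g from rfl] at h
  rw [h, rank_eq_sum]
  rcases le_total d g with hdg | hdg
  · refine Finset.sum_subset (by intro j; simp; omega) fun j _ hj => ?_
    rw [Nat.choose_eq_zero_of_lt (by simp at hj; omega), zero_mul]
  · refine (Finset.sum_subset (by intro j; simp; omega) fun j _ hj => ?_).symm
    rw [Nat.choose_eq_zero_of_lt (n := g) (by simp at hj; omega), mul_zero]

theorem choose_le_choose_of_le_half {d a b : ℕ} (hab : a ≤ b) (hb : 2 * b ≤ d) :
    d.choose a ≤ d.choose b := by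
  induction b, hab using Nat.le_induction with
  | base => rfl
  | succ b hab ih =>
    exact (ih (by omega)).trans (Nat.choose_le_succ_of_lt_half_left (by omega))

/-- For `j < g / 2` the term of `j` is at most that of `g - j`: the factors `g.choose` agree, and
`d.choose` increases up to `d / 2 ≥ g`. So the poor half of the sum is dominated by the rich half.
-/
theorem rank_le_two_mul_ncard_richMonomials {d g : ℕ} (h : 2 * g ≤ d) :
    rank d g ≤ 2 * (richMonomials d g).ncard := by
  classical
  have hr : (richMonomials d g).ncard =
      ∑ j ∈ (Finset.range (d + 1)).filter (fun j => g ≤ 2 * j), d.choose j * g.choose j := by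
    rw [← ncard_filter_support]
    congr 1
    ext e
    simp only [richMonomials, Set.mem_ofPred_eq]
    refine and_congr_right fun _ => ?_
    rw [div_le_iff₀ (by norm_num), mul_comm]
    exact_mod_cast Iff.rfl
  have hsub : ∑ j ∈ (Finset.range (g + 1)).filter (fun j => g ≤ 2 * j), d.choose j * g.choose j ≤
      (richMonomials d g).ncard := by
    rw [hr]
    refine Finset.sum_le_sum_of_subset fun j => ?_
    simp only [Finset.mem_filter, Finset.mem_range]
    omega
  have hrefl : ∑ j ∈ (Finset.range (g + 1)).filter (fun j => ¬ g ≤ 2 * j),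
        d.choose j * g.choose j ≤
      ∑ j ∈ (Finset.range (g + 1)).filter (fun j => g ≤ 2 * j), d.choose j * g.choose j := by
    calc _ ≤ ∑ j ∈ (Finset.range (g + 1)).filter (fun j => ¬ g ≤ 2 * j),
          d.choose (g - j) * g.choose (g - j) := by
          refine Finset.sum_le_sum fun j hj => ?_
          simp only [Finset.mem_filter, Finset.mem_range] at hj
          rw [Nat.choose_symm (n := g) (by omega)]
          exact Nat.mul_le_mul_right _ (choose_le_choose_of_le_half (by omega) (by omega))
      _ = ∑ j ∈ ((Finset.range (g + 1)).filter (fun j => ¬ g ≤ 2 * j)).image (g - ·),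
          d.choose j * g.choose j := by
          rw [Finset.sum_image]
          intro a ha b hb hab
          simp at ha hb hab
          omega
      _ ≤ _ := by
          refine Finset.sum_le_sum_of_subset fun j => ?_
          simp only [Finset.mem_filter, Finset.mem_range, Finset.mem_image]
          rintro ⟨a, ha, rfl⟩
          omega
  rw [rank_eq_sum, ← Finset.sum_filter_add_sum_filter_not _ (fun j => g ≤ 2 * j)]
  omega

end ApproxAttention

/-! ### Segments of an execution and the potential argument -/

namespace Pebbling

variable {V : Type*} {G : Digraph V} {M : ℕ}

theorem Run.redCount_le {c c' : Config V} {k : ℕ} (h : Run G M c c' k) (hc : c.redCount ≤ M) :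
    c'.redCount ≤ M := by
  cases h with
  | refl => exact hc
  | tail _ _ hcap => exact hcap

/-- What happened during a part of an execution that leads from `c` to `c'`: the nodes in `L` had a
value in fast memory at the beginning or were loaded, those in `W` were saved, and those in `A` are
the ones whose final value was available in fast memory at some time. -/
structure Trace (G : Digraph V) (c c' : Config V) (L W A : Set V) : Prop where
  red_subset : ∀ v, c.fast v ≠ none → v ∈ L
  available : ∀ v ∈ A, v ∈ L ∨ (∃ u, G.Adj u v) ∧ ∀ u, G.Adj u v → u ∈ A
  fast_final : ∀ v S, c'.fast v = some S → IsFinal G v S → v ∈ A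
  -- This makes `available` inductive: a node outside `L` was started from scratch, so everything
  -- aggregated into it was available.
  fast_fresh : ∀ v S, c'.fast v = some S → v ∈ L ∨ (∃ u, G.Adj u v) ∧ S ⊆ A
  -- A value descends from the fast copy or from the slow copy held at the beginning; the two are
  -- never merged. A value started from scratch satisfies both alternatives.
  fast_subset : ∀ v S, c'.fast v = some S →
    S ⊆ (c.fast v).getD ∅ ∪ A ∨ S ⊆ (c.slow v).getD ∅ ∪ A
  slow_subset : ∀ v S, c'.slow v = some S →
    S ⊆ (c.fast v).getD ∅ ∪ A ∨ S ⊆ (c.slow v).getD ∅ ∪ A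
  slow_eq : ∀ v, v ∉ W → c'.slow v = c.slow v

/-- Nodes with partial values are put into `A` too, here and in `Trace.load`. This is harmless,
since they lie in `L`. -/
theorem Trace.refl (c : Config V) :
    Trace G c c {v | c.fast v ≠ none} ∅ {v | c.fast v ≠ none} where
  red_subset _ h := h
  available _ h := Or.inl h
  fast_final v S h _ := by simp [h]
  fast_fresh v S h := by simp [h]
  fast_subset v S h := by simp [h]
  slow_subset v S h := by simp [h]
  slow_eq _ _ := rfl

open Classical in
theorem Trace.load {c c' : Config V} {L W A : Set V} (h : Trace G c c' L W A) {v : V} {S : Set V}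
    (hv : c'.slow v = some S) :
    Trace G c ⟨Function.update c'.fast v (some S), c'.slow⟩ (insert v L) W (insert v A) where
  red_subset w hw := Or.inr (h.red_subset w hw)
  available w hw := by
    rcases hw with rfl | hw
    · exact Or.inl (Or.inl rfl)
    · rcases h.available w hw with h1 | ⟨h1, h2⟩
      · exact Or.inl (Or.inr h1)
      · exact Or.inr ⟨h1, fun u hu => Or.inr (h2 u hu)⟩
  fast_final w T hw hT := by
    by_cases hwv : w = v
    · exact Or.inl hwv
    · simp only [Function.update_of_ne hwv] at hw
      exact Or.inr (h.fast_final w T hw hT)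
  fast_fresh w T hw := by
    by_cases hwv : w = v
    · exact Or.inl (Or.inl hwv)
    · simp only [Function.update_of_ne hwv] at hw
      rcases h.fast_fresh w T hw with h1 | ⟨h1, h2⟩
      · exact Or.inl (Or.inr h1)
      · exact Or.inr ⟨h1, h2.trans (Set.subset_insert _ _)⟩
  fast_subset w T hw := by
    have key : T ⊆ (c.fast w).getD ∅ ∪ A ∨ T ⊆ (c.slow w).getD ∅ ∪ A := by
      by_cases hwv : w = v
      · subst hwv
        simp only [Function.update_self, Option.some.injEq] at hw
        exact hw ▸ h.slow_subset w S hv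
      · simp only [Function.update_of_ne hwv] at hw
        exact h.fast_subset w T hw
    exact key.imp (fun h => h.trans (Set.union_subset_union_right _ (Set.subset_insert _ _)))
      (fun h => h.trans (Set.union_subset_union_right _ (Set.subset_insert _ _)))
  slow_subset w T hw :=
    (h.slow_subset w T hw).imp
      (fun h => h.trans (Set.union_subset_union_right _ (Set.subset_insert _ _)))
      (fun h => h.trans (Set.union_subset_union_right _ (Set.subset_insert _ _)))
  slow_eq := h.slow_eq

open Classical in
theorem Trace.save {c c' : Config V} {L W A : Set V} (h : Trace G c c' L W A) {v : V} {S : Set V}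
    (hv : c'.fast v = some S) :
    Trace G c ⟨c'.fast, Function.update c'.slow v (some S)⟩ L (insert v W) A where
  red_subset := h.red_subset
  available := h.available
  fast_final := h.fast_final
  fast_fresh := h.fast_fresh
  fast_subset := h.fast_subset
  slow_subset w T hw := by
    by_cases hwv : w = v
    · subst hwv
      simp only [Function.update_self, Option.some.injEq] at hw
      exact hw ▸ h.fast_subset w S hv
    · simp only [Function.update_of_ne hwv] at hw
      exact h.slow_subset w T hw
  slow_eq w hw := by
    simp only [Set.mem_insert_iff, not_or] at hw
    simp only [Function.update_of_ne hw.1]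
    exact h.slow_eq w hw.2

open Classical in
theorem Trace.delete {c c' : Config V} {L W A : Set V} (h : Trace G c c' L W A) (v : V) :
    Trace G c ⟨Function.update c'.fast v none, c'.slow⟩ L W A := by
  have key : ∀ w T, Function.update c'.fast v none w = some T → c'.fast w = some T := by
    intro w T hw
    by_cases hwv : w = v
    · subst hwv; simp at hw
    · simpa [Function.update_of_ne hwv] using hw
  exact
    { red_subset := h.red_subset
      available := h.available
      fast_final := fun w T hw => h.fast_final w T (key w T hw)
      fast_fresh := fun w T hw => h.fast_fresh w T (key w T hw)
      fast_subset := fun w T hw => h.fast_subset w T (key w T hw)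
      slow_subset := h.slow_subset
      slow_eq := h.slow_eq }

-- Only here does a node enter `A` without entering `L`: its aggregation is complete, and if it is
-- outside `L`, its parents are available by `fast_fresh`.
open Classical in
theorem Trace.compute {c c' : Config V} {L W A : Set V} (h : Trace G c c' L W A) {u v : V}
    {S : Set V} (huv : G.Adj u v) (hu : c'.fast u = some S) (hS : IsFinal G u S) :
    Trace G c ⟨Function.update c'.fast v (some (insert u ((c'.fast v).getD ∅))), c'.slow⟩ L W
      (A ∪ {w | w = v ∧ IsFinal G v (insert u ((c'.fast v).getD ∅))}) := by
  have huA : u ∈ A := h.fast_final u S hu hS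
  have hnew : v ∈ L ∨ (∃ u, G.Adj u v) ∧ insert u ((c'.fast v).getD ∅) ⊆ A := by
    rcases hcv : c'.fast v with _ | T
    · exact Or.inr ⟨⟨u, huv⟩, by simpa using huA⟩
    · rcases h.fast_fresh v T hcv with h1 | ⟨h1, h2⟩
      · exact Or.inl h1
      · exact Or.inr ⟨h1, Set.insert_subset huA h2⟩
  have hold : (c'.fast v).getD ∅ ⊆ (c.fast v).getD ∅ ∪ A ∨
      (c'.fast v).getD ∅ ⊆ (c.slow v).getD ∅ ∪ A := by
    rcases hcv : c'.fast v with _ | T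
    · simp
    · exact h.fast_subset v T hcv
  have mono : ∀ {B T : Set V}, T ⊆ B ∪ A →
      T ⊆ B ∪ (A ∪ {w | w = v ∧ IsFinal G v (insert u ((c'.fast v).getD ∅))}) :=
    fun h => h.trans (Set.union_subset_union_right _ Set.subset_union_left)
  exact
    { red_subset := h.red_subset
      available := by
        rintro w (hw | ⟨rfl, hfin⟩)
        · rcases h.available w hw with h1 | ⟨h1, h2⟩
          · exact Or.inl h1
          · exact Or.inr ⟨h1, fun u hu => Or.inl (h2 u hu)⟩
        · rcases hnew with h1 | ⟨h1, h2⟩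
          · exact Or.inl h1
          · exact Or.inr ⟨h1, fun x hx => Or.inl (h2 (hfin x hx))⟩
      fast_final := by
        intro w T hw hT
        by_cases hwv : w = v
        · subst hwv
          simp only [Function.update_self, Option.some.injEq] at hw
          exact Or.inr ⟨rfl, hw ▸ hT⟩
        · simp only [Function.update_of_ne hwv] at hw
          exact Or.inl (h.fast_final w T hw hT)
      fast_fresh := by
        intro w T hw
        by_cases hwv : w = v
        · subst hwv
          simp only [Function.update_self, Option.some.injEq] at hw
          subst hw
          exact hnew.imp id fun h => ⟨h.1, h.2.trans Set.subset_union_left⟩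
        · simp only [Function.update_of_ne hwv] at hw
          exact (h.fast_fresh w T hw).imp id fun h => ⟨h.1, h.2.trans Set.subset_union_left⟩
      fast_subset := by
        intro w T hw
        by_cases hwv : w = v
        · subst hwv
          simp only [Function.update_self, Option.some.injEq] at hw
          subst hw
          exact hold.imp (fun h => Set.insert_subset (Or.inr (Or.inl huA)) (mono h))
            (fun h => Set.insert_subset (Or.inr (Or.inl huA)) (mono h))
        · simp only [Function.update_of_ne hwv] at hw
          exact (h.fast_subset w T hw).imp mono mono
      slow_subset := fun w T hw => (h.slow_subset w T hw).imp mono mono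
      slow_eq := h.slow_eq }

/-- Only loads enlarge `L` and only saves enlarge `W`, each by at most one node at cost one. -/
theorem Run.exists_trace {c c' : Config V} {k : ℕ} (h : Run G M c c' k) :
    ∃ L W A : Set V, Trace G c c' L W A ∧ L.encard ≤ c.redCount + k ∧ W.encard ≤ k := by
  induction h with
  | refl => exact ⟨_, _, _, Trace.refl c, by simp [Config.redCount], by simp⟩
  | tail hrun hstep hcap ih =>
    obtain ⟨L, W, A, hT, hL, hW⟩ := ih
    cases hstep with
    | load v S hv =>
      refine ⟨_, _, _, hT.load hv, (Set.encard_insert_le _ _).trans ?_, hW.trans (by simp)⟩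
      push_cast
      rw [← add_assoc]
      gcongr
    | save v S hv =>
      refine ⟨_, _, _, hT.save hv, hL.trans (by push_cast; rw [← add_assoc]; exact le_self_add),
        (Set.encard_insert_le _ _).trans ?_⟩
      push_cast
      gcongr
    | delete v => exact ⟨_, _, _, hT.delete v, by simpa using hL, by simpa using hW⟩
    | compute u v S huv hu hS hv =>
      exact ⟨_, _, _, hT.compute huv hu hS, by simpa using hL, by simpa using hW⟩

theorem Step.cost_le_one {c c' : Config V} {k : ℕ} (h : Step G c c' k) : k ≤ 1 := by
  cases h <;> simp

/-- If a potential grows by at most `B` in every part of an execution with at most `M` loads and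
saves, then it is at most `(k / M + 1) * B` after an execution of cost `k`. -/
theorem Run.potential_le {φ : Config V → ℝ} {B : ℝ} (hM : 1 ≤ M) (hB : 0 ≤ B)
    (hφ : ∀ (c c' : Config V) (k : ℕ), k ≤ M → c.redCount ≤ M → Run G M c c' k → φ c' ≤ φ c + B)
    {c c' : Config V} {k : ℕ} (hc : c.redCount ≤ M) (h : Run G M c c' k) :
    φ c' ≤ φ c + ((k : ℝ) / M + 1) * B := by
  -- Greedy cutting: `N` segments have been closed before `c₁`, and the open one has cost `k₂`. It
  -- accounts for the `+ 1` in the bound.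
  have key : ∃ (c₁ : Config V) (k₁ k₂ N : ℕ), k = k₁ + k₂ ∧ k₂ ≤ M ∧ N * M ≤ k₁ ∧
      c₁.redCount ≤ M ∧ Run G M c₁ c' k₂ ∧ φ c₁ ≤ φ c + N * B := by
    induction h with
    | refl => exact ⟨c, 0, 0, 0, rfl, Nat.zero_le _, by simp, hc, Run.refl _, by simp⟩
    | @tail c' c'' k l hrun hstep hcap ih =>
      obtain ⟨c₁, k₁, k₂, N, hk, hk₂, hN, hc₁, hr, hp⟩ := ih
      by_cases hl : k₂ + l ≤ M
      · exact ⟨c₁, k₁, k₂ + l, N, by omega, hl, hN, hc₁, hr.tail hstep hcap, hp⟩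
      -- A step costs at most one, so an overflow means that the open segment has cost exactly `M`
      -- and can be closed.
      · have h1 := hstep.cost_le_one
        refine ⟨c', k₁ + k₂, l, N + 1, by omega, by omega, by rw [add_mul]; omega,
          hr.redCount_le hc₁, ?_, ?_⟩
        · simpa using (Run.refl c').tail hstep hcap
        · have := hφ c₁ c' k₂ hk₂ hc₁ hr
          push_cast
          linarith
  obtain ⟨c₁, k₁, k₂, N, hk, hk₂, hN, hc₁, hr, hp⟩ := key
  have h1 := hφ c₁ c' k₂ hk₂ hc₁ hr
  have hM' : (0 : ℝ) < M := by exact_mod_cast hM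
  have h2 : (N : ℝ) ≤ k / M := by
    rw [le_div_iff₀ hM']
    exact_mod_cast (by omega : N * M ≤ k)
  nlinarith

theorem start_redCount_le : (start G).redCount ≤ M := by
  simp [Config.redCount, start]

theorem ofReal_le_optimalCost {x : ℝ}
    (h : ∀ c k, Run G M (start G) c k → IsFinished G c → x ≤ k) :
    ENNReal.ofReal x ≤ ((optimalCost G M : ℕ∞) : ℝ≥0∞) := by
  have h1 : ((⌈x⌉₊ : ℕ) : ℕ∞) ≤ optimalCost G M := by
    refine le_iInf fun k => le_iInf fun ⟨c, hr, hf⟩ => ?_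
    exact_mod_cast Nat.ceil_le.2 (h c k hr hf)
  calc ENNReal.ofReal x ≤ ENNReal.ofReal (⌈x⌉₊ : ℝ) := ENNReal.ofReal_le_ofReal (Nat.le_ceil x)
    _ = (((⌈x⌉₊ : ℕ) : ℕ∞) : ℝ≥0∞) := by simp
    _ ≤ _ := by exact_mod_cast h1

end Pebbling

/-! ### A projection inequality -/

/-- The discrete Loomis–Whitney inequality in dimension three. -/
theorem Finset.card_sq_le_card_image_mul_card_image_mul_card_image {α β γ : Type*} [DecidableEq α]
    [DecidableEq β] [DecidableEq γ] (T : Finset (α × β × γ)) :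
    T.card ^ 2 ≤ (T.image fun x => (x.1, x.2.1)).card * (T.image fun x => (x.2.1, x.2.2)).card *
      (T.image fun x => (x.1, x.2.2)).card := by
  set A := T.image fun x => (x.1, x.2.1) with hA
  set B := T.image fun x => (x.2.1, x.2.2) with hB
  set C := T.image fun x => (x.1, x.2.2) with hC
  set E := T.image fun x => x.2.1 with hE
  have hT : T.card = ∑ e ∈ E, (T.filter fun x => x.2.1 = e).card :=
    Finset.card_eq_sum_card_fiberwise fun x hx => Finset.mem_image_of_mem _ hx
  have hAc : A.card = ∑ e ∈ E, (A.filter fun x => x.2 = e).card := by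
    refine Finset.card_eq_sum_card_fiberwise fun y hy => ?_
    obtain ⟨x, hx, rfl⟩ := Finset.mem_image.1 hy
    exact Finset.mem_image_of_mem _ hx
  have hBc : B.card = ∑ e ∈ E, (B.filter fun x => x.1 = e).card := by
    refine Finset.card_eq_sum_card_fiberwise fun y hy => ?_
    obtain ⟨x, hx, rfl⟩ := Finset.mem_image.1 hy
    exact Finset.mem_image_of_mem _ hx
  have h1 : ∀ e, (T.filter fun x => x.2.1 = e).card ≤ C.card := by
    intro e
    refine Finset.card_le_card_of_injOn (fun x => (x.1, x.2.2)) ?_ ?_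
    · intro x hx
      exact Finset.mem_image_of_mem _ (Finset.mem_filter.1 hx).1
    · rintro ⟨x1, x2, x3⟩ hx ⟨y1, y2, y3⟩ hy hxy
      simp only [Finset.coe_filter, Set.mem_ofPred_eq, Prod.mk.injEq] at hx hy hxy ⊢
      exact ⟨hxy.1, hx.2.trans hy.2.symm, hxy.2⟩
  have h2 : ∀ e, (T.filter fun x => x.2.1 = e).card ≤
      (A.filter fun x => x.2 = e).card * (B.filter fun x => x.1 = e).card := by
    intro e
    rw [← Finset.card_product]
    refine Finset.card_le_card_of_injOn (fun x => ((x.1, x.2.1), (x.2.1, x.2.2))) ?_ ?_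
    · intro x hx
      have hx := Finset.mem_filter.1 hx
      simp only [Finset.coe_product, Set.mem_prod, Finset.mem_coe, Finset.mem_filter]
      exact ⟨⟨Finset.mem_image_of_mem _ hx.1, hx.2⟩, ⟨Finset.mem_image_of_mem _ hx.1, hx.2⟩⟩
    · rintro ⟨x1, x2, x3⟩ _ ⟨y1, y2, y3⟩ _ hxy
      simp only [Prod.mk.injEq] at hxy ⊢
      tauto
  -- Cauchy–Schwarz over the middle coordinate `e`: the slice of `T` at `e` injects into `C` and
  -- into the product of the slices of `A` and `B`, so its squared size is at most the product of
  -- these three sizes.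
  have hcs := Finset.sum_sq_le_sum_mul_sum_of_sq_le_mul (R := ℝ) E
    (r := fun e => ((T.filter fun x => x.2.1 = e).card : ℝ))
    (f := fun e => ((A.filter fun x => x.2 = e).card : ℝ))
    (g := fun e => ((B.filter fun x => x.1 = e).card : ℝ) * C.card)
    (fun e _ => by positivity) (fun e _ => by positivity)
    (fun e _ => by
      rw [pow_two, ← mul_assoc]
      exact_mod_cast Nat.mul_le_mul (h2 e) (h1 e))
  rw [← Finset.sum_mul] at hcs
  rw [hT, hAc, hBc]
  rw [← mul_assoc] at hcs
  exact_mod_cast hcs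

theorem Finset.card_le_of_injOn_of_encard_le {α V : Type*} {L : Set V} {m : ℕ}
    (hL : L.encard ≤ m) (T : Finset α) (f : α → V) (hf : Set.InjOn f T) (hT : ∀ x ∈ T, f x ∈ L) :
    T.card ≤ m := by
  have h1 : ((T : Set α).encard) ≤ L.encard := by
    rw [← hf.encard_image]
    exact Set.encard_le_encard (by rintro _ ⟨x, hx, rfl⟩; exact hT x hx)
  rw [Set.encard_coe_eq_coe_finsetCard] at h1
  exact_mod_cast h1.trans hL

/-! ### The lower bound -/

namespace ApproxAttention

open Pebbling

variable {n d : ℕ} {J : Set (Fin d → ℕ)}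

theorem Trace.V_mem {c c' : Config (Node n d J)} {L W A : Set (Node n d J)}
    (h : Trace (dag n d J) c c' L W A) {i : Fin n} {k : Fin d} (hA : .V i k ∈ A) :
    .V i k ∈ L := by
  rcases h.available _ hA with h | ⟨⟨u, hu⟩, -⟩
  · exact h
  · cases hu

theorem Trace.Q_mem {c c' : Config (Node n d J)} {L W A : Set (Node n d J)}
    (h : Trace (dag n d J) c c' L W A) {i : Fin n} {k : Fin d} (hA : .Q i k ∈ A) :
    .Q i k ∈ L := by
  rcases h.available _ hA with h | ⟨⟨u, hu⟩, -⟩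
  · exact h
  · cases hu

open Classical in
/-- The entries of `H` that become available with few loads: this is where `#R ≤ n` is needed. -/
theorem Trace.card_H_le {c c' : Config (Node n d J)} {L W A : Set (Node n d J)}
    (h : Trace (dag n d J) c c' L W A) {m : ℕ} (hL : L.encard ≤ m) (R : Finset J)
    (hR : R.card ≤ n) (hn : 1 ≤ n) :
    ((R ×ˢ (Finset.univ : Finset (Fin d))).filter fun x => Node.H x.1 x.2 ∈ A).card ≤ 3 * m := by
  set T := (R ×ˢ (Finset.univ : Finset (Fin d))).filter fun x => Node.H x.1 x.2 ∈ A with hT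
  -- An available entry of `H` lies in `L`, or one of its products does, or all its `n` products
  -- were computed, which needs the full column `k` of `V`.
  have hsub : T ⊆ (T.filter fun x => Node.H x.1 x.2 ∈ L) ∪
      (T.filter fun x => ∃ i, Node.prodH i x.1 x.2 ∈ L) ∪
      (R ×ˢ (Finset.univ.filter fun k => ∀ i, Node.V i k ∈ L)) := by
    rintro ⟨e, k⟩ hx
    have hx' := (Finset.mem_filter.1 hx)
    simp only [Finset.mem_union, Finset.mem_filter, Finset.mem_product, Finset.mem_univ, true_and]
    by_cases h1 : Node.H e k ∈ L
    · exact Or.inl (Or.inl ⟨hx, h1⟩)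
    by_cases h2 : ∃ i, Node.prodH i e k ∈ L
    · exact Or.inl (Or.inr ⟨hx, h2⟩)
    refine Or.inr ⟨(Finset.mem_product.1 hx'.1).1, fun i => ?_⟩
    push Not at h2
    have h3 := ((h.available _ hx'.2).resolve_left h1).2 _ (Edge.prodH_H i e k)
    exact Trace.V_mem h (((h.available _ h3).resolve_left (h2 i)).2 _ (Edge.V_prodH i e k))
  have b1 : (T.filter fun x => Node.H x.1 x.2 ∈ L).card ≤ m :=
    Finset.card_le_of_injOn_of_encard_le hL _ (fun x => Node.H x.1 x.2)
      (by rintro ⟨a, b⟩ _ ⟨a', b'⟩ _ h; simpa using h) (fun x hx => (Finset.mem_filter.1 hx).2)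
  have b2 : (T.filter fun x => ∃ i, Node.prodH i x.1 x.2 ∈ L).card ≤ m := by
    -- One witnessing row per pair `(e, k)` makes the map into `L` injective; row `0` is a dummy for
    -- pairs without a witness.
    have : ∀ x : J × Fin d, ∃ i : Fin n, (∃ i, Node.prodH i x.1 x.2 ∈ L) →
        Node.prodH i x.1 x.2 ∈ L := by
      intro x
      by_cases hx : ∃ i : Fin n, Node.prodH i x.1 x.2 ∈ L
      · exact ⟨hx.choose, fun _ => hx.choose_spec⟩
      · exact ⟨⟨0, hn⟩, fun h => absurd h hx⟩
    choose f hf using this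
    exact Finset.card_le_of_injOn_of_encard_le hL _ (fun x => Node.prodH (f x) x.1 x.2)
      (by rintro ⟨a, b⟩ _ ⟨a', b'⟩ _ h; simp at h; simp [h])
      (fun x hx => hf x (Finset.mem_filter.1 hx).2)
  -- The full columns of `V` in `L` occupy `n` nodes each, and each of them serves at most `R.card ≤
  -- n` entries of `H`.
  have b3 : (R ×ˢ (Finset.univ.filter fun k => ∀ i, Node.V (J := J) i k ∈ L)).card ≤ m := by
    rw [Finset.card_product]
    have : ((Finset.univ : Finset (Fin n)) ×ˢ
        (Finset.univ.filter fun k => ∀ i, Node.V (J := J) i k ∈ L)).card ≤ m :=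
      Finset.card_le_of_injOn_of_encard_le hL _ (fun x => Node.V x.1 x.2)
        (by rintro ⟨a, b⟩ _ ⟨a', b'⟩ _ h; simpa using h)
        (fun x hx => (Finset.mem_filter.1 (Finset.mem_product.1 hx).2).2 _)
    rw [Finset.card_product, Finset.card_univ, Fintype.card_fin] at this
    exact (Nat.mul_le_mul_right _ hR).trans this
  calc T.card ≤ _ := Finset.card_le_card hsub
    _ ≤ _ := Finset.card_union_le _ _
    _ ≤ m + m + m := Nat.add_le_add ((Finset.card_union_le _ _).trans (Nat.add_le_add b1 b2)) b3
    _ = 3 * m := by ring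

open Classical in
/-- The rows for which many entries of `Q` are available. -/
theorem card_rows_mul_le {L : Set (Node n d J)} {m g : ℕ} (hL : L.encard ≤ m) (R : Finset J)
    (hR : ∀ e ∈ R, g ≤ 2 * (Finset.univ.filter fun k => e.1 k ≠ 0).card) :
    (Finset.univ.filter fun i : Fin n => ∃ e ∈ R, ∀ k, e.1 k ≠ 0 → Node.Q i k ∈ L).card * g ≤
      2 * m := by
  set I := Finset.univ.filter fun i : Fin n => ∃ e ∈ R, ∀ k, e.1 k ≠ 0 → Node.Q i k ∈ L with hI
  have h1 : (I.sigma fun i => Finset.univ.filter fun k => Node.Q (J := J) i k ∈ L).card ≤ m :=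
    Finset.card_le_of_injOn_of_encard_le hL _ (fun x => Node.Q x.1 x.2)
      (by rintro ⟨a, b⟩ _ ⟨a', b'⟩ _ h; simpa using h)
      (fun x hx => (Finset.mem_filter.1 (Finset.mem_sigma.1 hx).2).2)
  rw [Finset.card_sigma] at h1
  have h2 : ∀ i ∈ I, g ≤ 2 * (Finset.univ.filter fun k => Node.Q (J := J) i k ∈ L).card := by
    intro i hi
    obtain ⟨e, he, hk⟩ := (Finset.mem_filter.1 hi).2
    refine (hR e he).trans (Nat.mul_le_mul_left _ (Finset.card_le_card fun k hk' => ?_))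
    simpa using hk k (by simpa using hk')
  calc I.card * g = ∑ i ∈ I, g := by simp
    _ ≤ ∑ i ∈ I, 2 * (Finset.univ.filter fun k => Node.Q (J := J) i k ∈ L).card :=
      Finset.sum_le_sum h2
    _ ≤ 2 * m := by rw [← Finset.mul_sum]; omega

open Classical in
/-- The number of products of the second multiplication that can be aggregated into the nodes in
`D` during a part of an execution. -/
theorem Trace.card_prodO_le {c c' : Config (Node n d J)} {L W A D : Set (Node n d J)}
    (h : Trace (dag n d J) c c' L W A) {m g : ℕ} (hL : L.encard ≤ m) (hD : D.encard ≤ m)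
    (R : Finset J) (hR : R.card ≤ n) (hn : 1 ≤ n) (hg : 1 ≤ g)
    (hRg : ∀ e ∈ R, g ≤ 2 * (Finset.univ.filter fun k => e.1 k ≠ 0).card) :
    (((Finset.univ ×ˢ R ×ˢ Finset.univ : Finset (Fin n × J × Fin d)).filter fun x =>
      Node.O x.1 x.2.2 ∈ D ∧ Node.prodO x.1 x.2.1 x.2.2 ∈ A).card : ℝ) ≤
      m + 6 * m ^ 2 / g + √(3 * m ^ 3) := by
  set P := (Finset.univ ×ˢ R ×ˢ Finset.univ : Finset (Fin n × J × Fin d)).filter fun x =>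
      Node.O x.1 x.2.2 ∈ D ∧ Node.prodO x.1 x.2.1 x.2.2 ∈ A with hP
  set B := (R ×ˢ (Finset.univ : Finset (Fin d))).filter fun x => Node.H x.1 x.2 ∈ A with hB
  set I := Finset.univ.filter fun i : Fin n => ∃ e ∈ R, ∀ k, e.1 k ≠ 0 → Node.Q i k ∈ L with hI
  set P₂ := P.filter fun x => Node.U₁ x.1 x.2.1 ∈ L ∧ Node.H x.2.1 x.2.2 ∈ A with hP₂
  have hBc : B.card ≤ 3 * m := Trace.card_H_le h hL R hR hn
  -- The cases: the product lies in `L`; its `U₁` factor lies in `L`; that factor was computed,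
  -- which puts row `i` into `I`.
  have hsub : P ⊆ (P.filter fun x => Node.prodO x.1 x.2.1 x.2.2 ∈ L) ∪ P₂ ∪ (I ×ˢ B) := by
    rintro ⟨i, e, k⟩ hx
    have hx' := Finset.mem_filter.1 hx
    have heR : e ∈ R := by simpa using hx'.1
    simp only [Finset.mem_union, Finset.mem_filter, Finset.mem_product, hP₂]
    by_cases h1 : Node.prodO i e k ∈ L
    · exact Or.inl (Or.inl ⟨hx, h1⟩)
    have h2 := ((h.available _ hx'.2.2).resolve_left h1).2
    have hU := h2 _ (Edge.U₁_prodO i e k)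
    have hH := h2 _ (Edge.H_prodO i e k)
    by_cases h3 : Node.U₁ i e ∈ L
    · exact Or.inl (Or.inr ⟨hx, h3, hH⟩)
    · refine Or.inr ⟨?_, ?_⟩
      · have h4 := ((h.available _ hU).resolve_left h3).2
        simp only [hI, Finset.mem_filter, Finset.mem_univ, true_and]
        exact ⟨e, heR, fun k hk => Trace.Q_mem h (h4 _ (Edge.Q_U₁ i k e hk))⟩
      · simp [hB, heR, hH]
  have b1 : (P.filter fun x => Node.prodO x.1 x.2.1 x.2.2 ∈ L).card ≤ m :=
    Finset.card_le_of_injOn_of_encard_le hL _ (fun x => Node.prodO x.1 x.2.1 x.2.2)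
      (by rintro ⟨a, b⟩ _ ⟨a', b'⟩ _ h; simp at h; ext <;> simp [h])
      (fun x hx => (Finset.mem_filter.1 hx).2)
  -- The three projections consist of `U₁` entries in `L`, of pairs in `B`, and of outputs in `D`.
  have b2 : P₂.card ^ 2 ≤ 3 * m ^ 3 := by
    refine (Finset.card_sq_le_card_image_mul_card_image_mul_card_image P₂).trans ?_
    calc _ ≤ m * (3 * m) * m := by
          refine Nat.mul_le_mul (Nat.mul_le_mul ?_ ?_) ?_
          · refine Finset.card_le_of_injOn_of_encard_le hL _ (fun x => Node.U₁ x.1 x.2)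
              (by rintro ⟨a, b⟩ _ ⟨a', b'⟩ _ h; simpa using h) ?_
            intro x hx
            obtain ⟨y, hy, rfl⟩ := Finset.mem_image.1 hx
            exact (Finset.mem_filter.1 hy).2.1
          · refine (Finset.card_le_card ?_).trans hBc
            intro x hx
            obtain ⟨y, hy, rfl⟩ := Finset.mem_image.1 hx
            have hy' := Finset.mem_filter.1 hy
            have hy'' := (Finset.mem_filter.1 hy'.1).1
            simp only [Finset.mem_product] at hy''
            simp only [hB, Finset.mem_filter, Finset.mem_product]
            exact ⟨hy''.2, hy'.2.2⟩
          · refine Finset.card_le_of_injOn_of_encard_le hD _ (fun x => Node.O x.1 x.2)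
              (by rintro ⟨a, b⟩ _ ⟨a', b'⟩ _ h; simpa using h) ?_
            intro x hx
            obtain ⟨y, hy, rfl⟩ := Finset.mem_image.1 hx
            exact (Finset.mem_filter.1 (Finset.mem_filter.1 hy).1).2.1
      _ = 3 * m ^ 3 := by ring
  have b2' : (P₂.card : ℝ) ≤ √(3 * m ^ 3) := Real.le_sqrt_of_sq_le (by exact_mod_cast b2)
  have hg' : (0 : ℝ) < g := by exact_mod_cast hg
  have b3 : ((I ×ˢ B).card : ℝ) ≤ 6 * m ^ 2 / g := by
    rw [le_div_iff₀ hg', Finset.card_product]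
    have h1 : I.card * g ≤ 2 * m := card_rows_mul_le hL R hRg
    calc ((I.card * B.card : ℕ) : ℝ) * g = ((I.card * g * B.card : ℕ) : ℝ) := by push_cast; ring
      _ ≤ ((2 * m * (3 * m) : ℕ) : ℝ) := by exact_mod_cast Nat.mul_le_mul h1 hBc
      _ = _ := by push_cast; ring
  have hc : P.card ≤ (P.filter fun x => Node.prodO x.1 x.2.1 x.2.2 ∈ L).card + P₂.card +
      (I ×ˢ B).card :=
    (Finset.card_le_card hsub).trans ((Finset.card_union_le _ _).trans
      (Nat.add_le_add_right (Finset.card_union_le _ _) _))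
  have hc' : (P.card : ℝ) ≤ (P.filter fun x => Node.prodO x.1 x.2.1 x.2.2 ∈ L).card + P₂.card +
      (I ×ˢ B).card := by exact_mod_cast hc
  have b1' : ((P.filter fun x => Node.prodO x.1 x.2.1 x.2.2 ∈ L).card : ℝ) ≤ m := by
    exact_mod_cast b1
  linarith

open Classical in
/-- The number of products that belong to columns in `R` and are contained in the value `S` of the
output entry `(i, k)`. -/
noncomputable def aggregated (R : Finset J) (i : Fin n) (k : Fin d)
    (S : Option (Set (Node n d J))) : ℕ :=
  (R.filter fun e => Node.prodO i e k ∈ S.getD ∅).card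

/-- The number of products that belong to columns in `R` and have been aggregated into the best
available values of the output entries. -/
noncomputable def progress (R : Finset J) (c : Config (Node n d J)) : ℕ :=
  ∑ x : Fin n × Fin d, max (aggregated R x.1 x.2 (c.fast (.O x.1 x.2)))
    (aggregated R x.1 x.2 (c.slow (.O x.1 x.2)))

open Classical in
theorem aggregated_le (R : Finset J) (i : Fin n) (k : Fin d) {S T A : Set (Node n d J)}
    (h : S ⊆ T ∪ A) : aggregated R i k (some S) ≤ (R.filter fun e => .prodO i e k ∈ T).card +
      (R.filter fun e => Node.prodO i e k ∈ A).card := by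
  refine (Finset.card_le_card ?_).trans (Finset.card_union_le _ _)
  intro e he
  simp only [Finset.mem_filter, Finset.mem_union, Option.getD_some] at he ⊢
  exact (h he.2).imp (⟨he.1, ·⟩) (⟨he.1, ·⟩)

-- An output outside `D` has no fast copy at the end and an unchanged slow copy, so it makes no
-- progress. For an output in `D`, each copy is contained in an initial copy together with available
-- products.
open Classical in
theorem Trace.progress_le {c c' : Config (Node n d J)} {L W A D : Set (Node n d J)}
    (h : Trace (dag n d J) c c' L W A) (hD : ∀ v, v ∈ W ∨ c'.fast v ≠ none → v ∈ D) (R : Finset J) :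
    progress R c' ≤ progress R c +
      ((Finset.univ ×ˢ R ×ˢ Finset.univ : Finset (Fin n × J × Fin d)).filter fun x =>
        Node.O x.1 x.2.2 ∈ D ∧ Node.prodO x.1 x.2.1 x.2.2 ∈ A).card := by
  have hcard : ((Finset.univ ×ˢ R ×ˢ Finset.univ : Finset (Fin n × J × Fin d)).filter fun x =>
        Node.O x.1 x.2.2 ∈ D ∧ Node.prodO x.1 x.2.1 x.2.2 ∈ A).card =
      ∑ x : Fin n × Fin d, if Node.O x.1 x.2 ∈ D then
        (R.filter fun e => Node.prodO x.1 e x.2 ∈ A).card else 0 := by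
    rw [Finset.card_eq_sum_card_fiberwise (f := fun x => (x.1, x.2.2)) (t := Finset.univ)
      (fun _ _ => Finset.mem_coe.2 (Finset.mem_univ _))]
    refine Finset.sum_congr rfl fun x _ => ?_
    split_ifs with hx
    · refine Finset.card_bij (fun y _ => y.2.1) ?_ ?_ ?_
      · rintro ⟨i, e, k⟩ hy
        simp only [Finset.mem_filter, Finset.mem_product] at hy ⊢
        obtain ⟨⟨hy1, hy2, hy3⟩, rfl⟩ := hy
        exact ⟨hy1.2.1, hy3⟩
      · rintro ⟨i, e, k⟩ hy ⟨i', e', k'⟩ hy' hee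
        have h1 := (Finset.mem_filter.1 hy).2.trans (Finset.mem_filter.1 hy').2.symm
        simp only [Prod.mk.injEq] at h1 hee ⊢
        exact ⟨h1.1, hee, h1.2⟩
      · intro e he
        simp only [Finset.mem_filter] at he
        exact ⟨(x.1, e, x.2), by simpa using ⟨he.1, by simpa using hx, he.2⟩, rfl⟩
    · rw [Finset.card_eq_zero, Finset.filter_eq_empty_iff]
      rintro y hy rfl
      exact hx (Finset.mem_filter.1 hy).2.1
  rw [hcard, progress, progress, ← Finset.sum_add_distrib]
  refine Finset.sum_le_sum fun x _ => ?_
  obtain ⟨i, k⟩ := x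
  dsimp only
  have hnone : aggregated R i k (none : Option (Set (Node n d J))) = 0 := by simp [aggregated]
  have key : ∀ S : Set (Node n d J),
      S ⊆ (c.fast (.O i k)).getD ∅ ∪ A ∨ S ⊆ (c.slow (.O i k)).getD ∅ ∪ A →
      aggregated R i k (some S) ≤
      max (aggregated R i k (c.fast (.O i k))) (aggregated R i k (c.slow (.O i k))) +
        (R.filter fun e => Node.prodO i e k ∈ A).card := by
    rintro S (hS | hS)
    · exact (aggregated_le R i k hS).trans (Nat.add_le_add_right (le_max_left _ _) _)
    · exact (aggregated_le R i k hS).trans (Nat.add_le_add_right (le_max_right _ _) _)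
  by_cases hx : Node.O i k ∈ D
  · rw [if_pos hx]
    refine max_le ?_ ?_
    · rcases hf : c'.fast (.O i k) with _ | S
      · rw [hnone]; exact Nat.zero_le _
      · exact key S (h.fast_subset _ S hf)
    · rcases hf : c'.slow (.O i k) with _ | S
      · rw [hnone]; exact Nat.zero_le _
      · exact key S (h.slow_subset _ S hf)
  · rw [if_neg hx]
    replace hx := mt (hD _) hx
    simp only [not_or, not_not] at hx
    rw [hx.2, hnone, h.slow_eq _ hx.1]
    simp

theorem progress_start (R : Finset J) : progress R (start (dag n d J)) = 0 := by
  rw [progress]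
  refine Finset.sum_eq_zero fun x _ => ?_
  have h : ∀ v, ((start (dag n d J)).slow v).getD ∅ = ∅ := by
    intro v
    unfold start
    dsimp only
    split_ifs <;> rfl
  have h' : (start (dag n d J)).fast (.O x.1 x.2) = none := rfl
  simp [aggregated, h, h']

open Classical in
theorem progress_of_isFinished (R : Finset J) {c : Config (Node n d J)}
    (h : IsFinished (dag n d J) c) : n * d * R.card ≤ progress R c := by
  have h1 : ∀ x : Fin n × Fin d, R.card ≤ aggregated R x.1 x.2 (c.slow (.O x.1 x.2)) := by
    rintro ⟨i, k⟩
    obtain ⟨S, hS, hf⟩ := h (.O i k) (fun w hw => by cases hw)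
    rw [aggregated, hS, Finset.filter_true_of_mem]
    exact fun e _ => hf _ (Edge.prodO_O i e k)
  calc n * d * R.card = ∑ x : Fin n × Fin d, R.card := by simp
    _ ≤ _ := Finset.sum_le_sum fun x _ => (h1 x).trans (le_max_right _ _)

/-- All output entries have to be saved. -/
theorem mul_le_of_run {M k : ℕ} (e : J) {c : Config (Node n d J)}
    (h : Run (dag n d J) M (start (dag n d J)) c k) (hf : IsFinished (dag n d J) c) :
    n * d ≤ k := by
  obtain ⟨L, W, A, hT, -, hW⟩ := h.exists_trace
  have h1 := Finset.card_le_of_injOn_of_encard_le hW (Finset.univ : Finset (Fin n × Fin d))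
    (fun x => Node.O x.1 x.2) (by rintro ⟨a, b⟩ _ ⟨a', b'⟩ _ h; simpa using h) ?_
  · simpa using h1
  rintro ⟨i, k⟩ -
  by_contra hx
  obtain ⟨S, hS, -⟩ := hf (.O i k) (fun w hw => by cases hw)
  rw [hT.slow_eq _ hx] at hS
  -- The column `e` gives the output a parent, so it is not a source and has no blue pebble at the
  -- start.
  have : ¬ ∀ u, ¬ (dag n d J).Adj u (.O i k) := fun h => h _ (Edge.prodO_O i e k)
  simp [start, this] at hS

theorem progress_le_of_run {M k g : ℕ} (R : Finset J) (hR : R.card ≤ n) (hn : 1 ≤ n) (hg : 1 ≤ g)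
    (hM : 1 ≤ M) (hgM : g ^ 2 ≤ M)
    (hRg : ∀ e ∈ R, g ≤ 2 * (Finset.univ.filter fun k => e.1 k ≠ 0).card)
    {c : Config (Node n d J)} (h : Run (dag n d J) M (start (dag n d J)) c k) :
    (progress R c : ℝ) ≤ ((k : ℝ) / M + 1) * (31 * M ^ 2 / g) := by
  have hg' : (0 : ℝ) < g := by exact_mod_cast hg
  have hM' : (0 : ℝ) < M := by exact_mod_cast hM
  have hgM' : (g : ℝ) ^ 2 ≤ M := by exact_mod_cast hgM
  have hgM1 : (g : ℝ) ≤ M := by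
    have : (1 : ℝ) ≤ g := by exact_mod_cast hg
    nlinarith
  -- With `m = 2 * M`, the three terms of `Trace.card_prodO_le` are at most `2`, `24` and `5` times
  -- `M ^ 2 / g`. The first uses `g ≤ M`; the third is `√(24 * M ^ 3)` and uses `g ^ 2 ≤ M`.
  have key := Run.potential_le (φ := fun c => (progress R c : ℝ)) (B := 31 * M ^ 2 / g) hM
    (by positivity) ?_ start_redCount_le h
  · simpa [progress_start] using key
  intro c c' k hk hc hr
  obtain ⟨L, W, A, hT, hL, hW⟩ := hr.exists_trace
  have hL' : L.encard ≤ (2 * M : ℕ) := by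
    refine hL.trans ((add_le_add hc (Nat.cast_le.2 hk)).trans ?_)
    rw [two_mul]; exact_mod_cast le_rfl
  have hD : (W ∪ {v | c'.fast v ≠ none}).encard ≤ (2 * M : ℕ) := by
    refine (Set.encard_union_le _ _).trans
      ((add_le_add (hW.trans (Nat.cast_le.2 hk)) (hr.redCount_le hc)).trans ?_)
    rw [two_mul]; exact_mod_cast le_rfl
  have h1 := Trace.card_prodO_le hT hL' hD R hR hn hg hRg
  have h2 := Nat.cast_le (α := ℝ).2
    (Trace.progress_le (D := W ∪ {v | c'.fast v ≠ none}) hT (fun _ hv => hv) R)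
  push_cast at h2
  have hs : √(3 * ((2 * M : ℕ) : ℝ) ^ 3) ≤ 5 * M ^ 2 / g := by
    rw [Real.sqrt_le_left (by positivity), div_pow, le_div_iff₀ (by positivity)]
    push_cast
    have : (M : ℝ) ^ 3 * g ^ 2 ≤ M ^ 3 * M := by gcongr
    nlinarith [pow_pos hM' 4]
  have hl : ((2 * M : ℕ) : ℝ) ≤ 2 * M ^ 2 / g := by
    rw [le_div_iff₀ hg']
    push_cast
    nlinarith
  have e1 : (6 : ℝ) * ((2 * M : ℕ) : ℝ) ^ 2 / g = 24 * M ^ 2 / g := by push_cast; ring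
  have e2 : (31 : ℝ) * M ^ 2 / g = 2 * M ^ 2 / g + 24 * M ^ 2 / g + 5 * M ^ 2 / g := by ring
  rw [e1] at h1
  rw [e2]
  linarith [h1, h2]

/-- The lower bound for any set of columns that contains the monomials with many variables. -/
theorem le_optimalCost_dag {g M : ℕ} (hJ : richMonomials d g ⊆ J) (hdg : 5 * g ≤ d) (hg : 1 ≤ g)
    (hgM : g ^ 2 ≤ M) (hM : 124 * M ≤ d * rank d g) (hn : rank d g ≤ n) :
    ENNReal.ofReal (1 / 124 * ((n : ℝ) * rank d g * d * g / M)) ≤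
      ((optimalCost (dag n d J) M : ℕ∞) : ℝ≥0∞) := by
  classical
  have hM1 : 1 ≤ M := (Nat.one_le_pow _ _ hg).trans hgM
  have hr1 : 1 ≤ rank d g := Nat.choose_pos (by omega)
  have hfin : (richMonomials d g).Finite := (finite_monomials d g).subset fun _ h => h.1
  have hncard : (richMonomials d g).ncard ≤ rank d g := by
    rw [← ncard_monomials]
    exact Set.ncard_le_ncard (fun _ h => h.1) (finite_monomials d g)
  have hrich := rank_le_two_mul_ncard_richMonomials (d := d) (g := g) (by omega)
  -- Only rich columns are counted, so further columns in `J` do not affect the argument.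
  set R : Finset J := hfin.toFinset.subtype (· ∈ J) with hRdef
  have hRcard : R.card = (richMonomials d g).ncard := by
    rw [hRdef, Finset.card_subtype, Set.ncard_eq_toFinset_card _ hfin,
      Finset.filter_true_of_mem fun e he => hJ (hfin.mem_toFinset.1 he)]
  have hRg : ∀ e ∈ R, g ≤ 2 * (Finset.univ.filter fun k => e.1 k ≠ 0).card := by
    intro e he
    have := (hfin.mem_toFinset.1 (Finset.mem_subtype.1 he)).2
    rw [div_le_iff₀ (by norm_num), mul_comm] at this
    exact_mod_cast this
  obtain ⟨e, he⟩ : R.Nonempty := by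
    rw [← Finset.card_pos]; omega
  refine ofReal_le_optimalCost fun c k hr hf => ?_
  have h1 : n * d ≤ k := mul_le_of_run e hr hf
  have h2 := progress_le_of_run R (by omega) (by omega) hg hM1 hgM hRg hr
  have h3 : ((n * d * R.card : ℕ) : ℝ) ≤ progress R c := by
    exact_mod_cast progress_of_isFinished R hf
  have h1' : (n : ℝ) * d ≤ k := by exact_mod_cast h1
  have hM0 : (0 : ℝ) < M := by exact_mod_cast hM1
  have hg0 : (0 : ℝ) < g := by exact_mod_cast hg
  have hnd : (0 : ℝ) ≤ (n : ℝ) * d := by positivity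
  -- If `rank d g * g ≤ M`, the claimed bound is at most `n * d`, the number of saved outputs.
  rcases le_total (rank d g * g) M with hcase | hcase
  · have hcase' : (rank d g : ℝ) * g ≤ M := by exact_mod_cast hcase
    rw [mul_div_assoc', div_le_iff₀ hM0]
    nlinarith [mul_le_mul h1' hcase' (by positivity) (by positivity),
      mul_nonneg hnd (by positivity : (0 : ℝ) ≤ (rank d g : ℝ) * g)]
  · have hcase' : (M : ℝ) ≤ rank d g * g := by exact_mod_cast hcase
    have hMnd : (124 : ℝ) * M ≤ n * d := by
      have : 124 * M ≤ n * d := hM.trans (by rw [mul_comm]; exact Nat.mul_le_mul_right _ hn)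
      exact_mod_cast this
    have hR2 : (rank d g : ℝ) ≤ 2 * R.card := by rw [hRcard]; exact_mod_cast hrich
    have h4 : (n : ℝ) * d * rank d g ≤ 2 * (((k : ℝ) / M + 1) * (31 * M ^ 2 / g)) := by
      have : (n : ℝ) * d * rank d g ≤ n * d * (2 * R.card) := by gcongr
      push_cast at h3
      linarith
    have h5 : 2 * (((k : ℝ) / M + 1) * (31 * M ^ 2 / g)) = 62 * (k * M + M ^ 2) / g := by
      field_simp
      ring
    rw [h5, le_div_iff₀ hg0] at h4
    -- This makes the term `62 * M ^ 2` of the last segment at most half of `n * d * rank d g * g`;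
    -- the other half is at most `62 * k * M`, whence the constant `124`.
    have h6 : (124 : ℝ) * M * M ≤ n * d * (rank d g * g) := by gcongr
    rw [mul_div_assoc', div_le_iff₀ hM0]
    nlinarith

end ApproxAttention

/-! ### Composing executions: loops and elementary batches -/

namespace Pebbling

variable {V : Type*} {G : Digraph V} {M : ℕ}

/-- The configuration `c'` can be reached from `c` at cost at most `k`. -/
def Reach (G : Digraph V) (M : ℕ) (c c' : Config V) (k : ℕ) : Prop :=
  ∃ l ≤ k, Run G M c c' l

theorem Reach.refl (c : Config V) : Reach G M c c 0 := ⟨0, le_rfl, Run.refl c⟩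

theorem Run.trans {c c' c'' : Config V} {k l : ℕ} (h : Run G M c c' k) (h' : Run G M c' c'' l) :
    Run G M c c'' (k + l) := by
  induction h' with
  | refl => exact h
  | tail _ hstep hcap ih => rw [← add_assoc]; exact ih.tail hstep hcap

theorem Reach.trans {c c' c'' : Config V} {k l : ℕ} (h : Reach G M c c' k)
    (h' : Reach G M c' c'' l) : Reach G M c c'' (k + l) := by
  obtain ⟨a, ha, hr⟩ := h
  obtain ⟨b, hb, hr'⟩ := h'
  exact ⟨a + b, by omega, hr.trans hr'⟩

theorem Reach.mono {c c' : Config V} {k l : ℕ} (h : Reach G M c c' k) (hkl : k ≤ l) :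
    Reach G M c c' l := by
  obtain ⟨a, ha, hr⟩ := h
  exact ⟨a, ha.trans hkl, hr⟩

theorem Reach.of_step {c c' : Config V} {k : ℕ} (h : Step G c c' k) (hcap : c'.redCount ≤ M) :
    Reach G M c c' k :=
  ⟨k, le_rfl, by simpa using (Run.refl c).tail h hcap⟩

/-- The configuration depends only on the set of processed elements, so the order of the loop is
irrelevant. -/
theorem Reach.loop {α : Type*} [DecidableEq α] (T : Finset α) (σ : Finset α → Config V)
    (w : α → ℕ)
    (h : ∀ s ⊆ T, ∀ x ∈ T, x ∉ s → Reach G M (σ s) (σ (insert x s)) (w x)) :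
    Reach G M (σ ∅) (σ T) (∑ x ∈ T, w x) := by
  suffices H : ∀ s : Finset α, s ⊆ T → Reach G M (σ ∅) (σ s) (∑ x ∈ s, w x) from H T subset_rfl
  intro s
  induction s using Finset.induction_on with
  | empty => exact fun _ => Reach.refl _
  | insert x s hx ih =>
    intro hs
    rw [Finset.sum_insert hx, add_comm]
    have hs' := Finset.insert_subset_iff.1 hs
    exact (ih hs'.2).trans (h s hs'.2 x hs'.1 hx)

theorem Reach.loop_const {α : Type*} [DecidableEq α] (T : Finset α) (σ : Finset α → Config V)
    (w : ℕ) (h : ∀ s ⊆ T, ∀ x ∈ T, x ∉ s → Reach G M (σ s) (σ (insert x s)) w) :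
    Reach G M (σ ∅) (σ T) (T.card * w) := by
  simpa using Reach.loop T σ (fun _ => w) h

/-- A loop over a set that is processed in `m` blocks of at most `b` elements. -/
theorem Reach.loop_blocks {α : Type*} [DecidableEq α] (T : Finset α) (σ : Finset α → Config V)
    (b w m : ℕ) (hm : T.card ≤ m * b)
    (h : ∀ s B, Disjoint s B → B.card ≤ b → Reach G M (σ s) (σ (s ∪ B)) w) :
    Reach G M (σ ∅) (σ T) (m * w) := by
  suffices H : ∀ s : Finset α, ∀ m, s.card ≤ m * b → Reach G M (σ ∅) (σ s) (m * w) from H T m hm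
  intro s m
  induction m generalizing s with
  | zero =>
    intro hs
    have : s = ∅ := by simpa using hs
    subst this
    simpa using Reach.refl _
  | succ m ih =>
    intro hs
    obtain ⟨B, hB, hBc⟩ := Finset.exists_subset_card_eq (s := s) (n := min b s.card)
      (min_le_right _ _)
    have h1 : (s \ B).card ≤ m * b := by
      rw [Finset.card_sdiff_of_subset hB, hBc]
      rw [add_mul] at hs
      omega
    have h2 := (ih _ h1).trans (h (s \ B) B Finset.sdiff_disjoint (by omega))
    rw [Finset.sdiff_union_of_subset hB] at h2
    exact h2.mono (by rw [add_mul, one_mul])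

theorem Config.redCount_mono {c c' : Config V} (h : ∀ v, c.fast v ≠ none → c'.fast v ≠ none) :
    c.redCount ≤ c'.redCount :=
  Set.encard_le_encard h

open Classical in
theorem Reach.load_finset (c : Config V) (A : Finset V) (hA : ∀ v ∈ A, c.slow v ≠ none)
    (hcap : (⟨fun v => if v ∈ A then c.slow v else c.fast v, c.slow⟩ : Config V).redCount ≤ M) :
    Reach G M c ⟨fun v => if v ∈ A then c.slow v else c.fast v, c.slow⟩ A.card := by
  have key := Reach.loop_const (G := G) (M := M) A
    (fun s => ⟨fun v => if v ∈ s then c.slow v else c.fast v, c.slow⟩) 1 ?_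
  · simpa using key
  intro s hs x hx hxs
  obtain ⟨S, hS⟩ := Option.ne_none_iff_exists'.1 (hA x hx)
  have h := Step.load (G := G) ⟨fun v => if v ∈ s then c.slow v else c.fast v, c.slow⟩ x S hS
  have heq : Function.update (fun v => if v ∈ s then c.slow v else c.fast v) x (some S) =
      fun v => if v ∈ insert x s then c.slow v else c.fast v := by
    funext v
    by_cases hv : v = x
    · subst hv; simp [hS]
    · simp [hv]
  simp only [heq] at h
  refine Reach.of_step h ((Config.redCount_mono ?_).trans hcap)
  intro v hv
  by_cases hvA : v ∈ A
  · simpa [hvA] using hA v hvA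
  · have : v ∉ insert x s := fun h => hvA (Finset.insert_subset hx hs h)
    simpa [hvA, this] using hv

open Classical in
theorem Reach.save_finset (c : Config V) (A : Finset V) (hA : ∀ v ∈ A, c.fast v ≠ none)
    (hcap : c.redCount ≤ M) :
    Reach G M c ⟨c.fast, fun v => if v ∈ A then c.fast v else c.slow v⟩ A.card := by
  have key := Reach.loop_const (G := G) (M := M) A
    (fun s => ⟨c.fast, fun v => if v ∈ s then c.fast v else c.slow v⟩) 1 ?_
  · simpa using key
  intro s hs x hx hxs
  obtain ⟨S, hS⟩ := Option.ne_none_iff_exists'.1 (hA x hx)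
  have h := Step.save (G := G) ⟨c.fast, fun v => if v ∈ s then c.fast v else c.slow v⟩ x S hS
  have heq : Function.update (fun v => if v ∈ s then c.fast v else c.slow v) x (some S) =
      fun v => if v ∈ insert x s then c.fast v else c.slow v := by
    funext v
    by_cases hv : v = x
    · subst hv; simp [hS]
    · simp [hv]
  simp only [heq] at h
  exact Reach.of_step h hcap

open Classical in
theorem Reach.delete_finset (c : Config V) (A : Finset V) (hcap : c.redCount ≤ M) :
    Reach G M c ⟨fun v => if v ∈ A then none else c.fast v, c.slow⟩ 0 := by
  have key := Reach.loop_const (G := G) (M := M) A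
    (fun s => ⟨fun v => if v ∈ s then none else c.fast v, c.slow⟩) 0 ?_
  · simpa using key
  intro s hs x hx hxs
  have h := Step.delete (G := G) ⟨fun v => if v ∈ s then none else c.fast v, c.slow⟩ x
  have heq : Function.update (fun v => if v ∈ s then none else c.fast v) x none =
      fun v => if v ∈ insert x s then none else c.fast v := by
    funext v
    by_cases hv : v = x
    · subst hv; simp
    · simp [hv]
  simp only [heq] at h
  refine Reach.of_step h ((Config.redCount_mono fun v hv => ?_).trans hcap)
  by_cases hvs : v ∈ insert x s
  · simp [hvs] at hv
  · simpa [hvs] using hv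

open Classical in
/-- The content of a node into which the parents in `S` have been aggregated. -/
noncomputable def partialValue (S : Set V) : Option (Set V) :=
  if S = ∅ then none else some S

@[simp] theorem partialValue_empty : partialValue (∅ : Set V) = none := by simp [partialValue]

theorem partialValue_of_nonempty {S : Set V} (h : S.Nonempty) : partialValue S = some S := by
  simp [partialValue, h.ne_empty]

@[simp] theorem partialValue_getD (S : Set V) : (partialValue S).getD ∅ = S := by
  unfold partialValue
  split_ifs with h
  · simp [h]
  · rfl

theorem partialValue_ne_none {S : Set V} : partialValue S ≠ none ↔ S.Nonempty := by
  simp [partialValue, Set.nonempty_iff_ne_empty]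

-- The parents are aggregated one by one. As `partialValue ∅ = none`, the loop starts at `c` itself,
-- and no intermediate stage has more red pebbles than the last.
open Classical in
theorem Reach.compute_node (c : Config V) (v : V) (P : Finset V) (hP : ∀ u, G.Adj u v ↔ u ∈ P)
    (hne : P.Nonempty) (hv : c.fast v = none)
    (hfinal : ∀ u, G.Adj u v → ∃ S, c.fast u = some S ∧ IsFinal G u S)
    (hcap : (⟨Function.update c.fast v (some {u | G.Adj u v}), c.slow⟩ : Config V).redCount ≤ M) :
    Reach G M c ⟨Function.update c.fast v (some {u | G.Adj u v}), c.slow⟩ 0 := by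
  have hPv : partialValue (P : Set V) = some {u | G.Adj u v} := by
    rw [partialValue_of_nonempty hne]
    congr 1
    ext u
    simp [hP]
  have key := Reach.loop_const (G := G) (M := M) P
    (fun s => ⟨Function.update c.fast v (partialValue (s : Set V)), c.slow⟩) 0 ?_
  · have h0 : Function.update c.fast v (partialValue ((∅ : Finset V) : Set V)) = c.fast := by
      simp [← hv]
    rw [h0, hPv] at key
    simpa using key
  intro s hs x hx hxs
  obtain ⟨S, hS, hSf⟩ := hfinal x ((hP x).2 hx)
  have hxv : x ≠ v := by rintro rfl; rw [hv] at hS; cases hS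
  have h := Step.compute (G := G) ⟨Function.update c.fast v (partialValue (s : Set V)), c.slow⟩ x v
    S ((hP x).2 hx) (by simpa [hxv] using hS) hSf (by simpa using hxs)
  simp only [Function.update_self, partialValue_getD, Function.update_idem] at h
  rw [← partialValue_of_nonempty (Set.insert_nonempty _ _), ← Finset.coe_insert] at h
  refine Reach.of_step h ((Config.redCount_mono fun w hw => ?_).trans hcap)
  by_cases hwv : w = v
  · subst hwv; simp
  · simpa [hwv] using hw

open Classical in
/-- The product `p` of `a` and `b` is aggregated into `t`. -/
theorem Reach.multiply_add (c : Config V) {a b p t : V} {Sa Sb : Set V}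
    (ha : c.fast a = some Sa) (hSa : IsFinal G a Sa) (hb : c.fast b = some Sb)
    (hSb : IsFinal G b Sb) (hab : a ≠ b) (hap : G.Adj a p) (hbp : G.Adj b p)
    (hp : ∀ u, G.Adj u p → u = a ∨ u = b) (hpt : G.Adj p t) (hne : p ≠ t) (hpn : c.fast p = none)
    (hnew : p ∉ (c.fast t).getD ∅)
    (hcap : (⟨Function.update c.fast t (some (insert p ((c.fast t).getD ∅))), c.slow⟩ :
      Config V).redCount + 1 ≤ M) :
    Reach G M c ⟨Function.update c.fast t (some (insert p ((c.fast t).getD ∅))), c.slow⟩ 0 := by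
  have hap' : a ≠ p := by rintro rfl; rw [hpn] at ha; cases ha
  have hbp' : b ≠ p := by rintro rfl; rw [hpn] at hb; cases hb
  set S := insert p ((c.fast t).getD ∅) with hS
  -- Every intermediate configuration has red pebbles only on nodes red at the end and on the
  -- transient product `p`, hence the `+ 1` in `hcap`.
  have hcap' : ∀ f : V → Option (Set V),
      (∀ v, v ≠ p → v ≠ t → f v ≠ none → c.fast v ≠ none) →
      (⟨f, c.slow⟩ : Config V).redCount ≤ M := by
    intro f hf
    refine le_trans ?_ hcap
    refine (Set.encard_le_encard (t := insert p _) ?_).trans (Set.encard_insert_le _ _)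
    intro v hv
    by_cases h1 : v = p
    · exact Or.inl h1
    · right
      by_cases h2 : v = t
      · subst h2; simp
      · simpa [h2] using hf v h1 h2 hv
  have s1 := Step.compute c a p Sa hap ha hSa (by simp [hpn])
  simp only [hpn, Option.getD_none] at s1
  have s2 := Step.compute (G := G) ⟨Function.update c.fast p (some (insert a ∅)), c.slow⟩ b p Sb hbp
    (by simpa [hbp'] using hb) hSb (by simpa using hab.symm)
  simp only [Function.update_self, Option.getD_some, Function.update_idem] at s2
  have s3 := Step.compute (G := G) ⟨Function.update c.fast p (some (insert b (insert a ∅))), c.slow⟩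
    p t (insert b (insert a ∅)) hpt (by simp) (fun u hu => by
      rcases hp u hu with rfl | rfl <;> simp) (by simpa [hne.symm] using hnew)
  simp only [Function.update_of_ne hne.symm, ← hS] at s3
  have s4 := Step.delete (G := G) ⟨Function.update (Function.update c.fast p
    (some (insert b (insert a ∅)))) t (some S), c.slow⟩ p
  have heq : Function.update (Function.update (Function.update c.fast p
      (some (insert b (insert a ∅)))) t (some S)) p none = Function.update c.fast t (some S) := by
    funext v
    by_cases h1 : v = p
    · subst h1; simp [hne, hpn]
    · by_cases h2 : v = t
      · subst h2; simp [h1]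
      · simp [h1, h2]
  rw [heq] at s4
  refine (((Reach.of_step s1 (hcap' _ ?_)).trans (Reach.of_step s2 (hcap' _ ?_))).trans
    (Reach.of_step s3 (hcap' _ ?_))).trans (Reach.of_step s4 (hcap' _ ?_))
  all_goals
    intro v h1 h2 h
    simpa [h1, h2] using h

theorem optimalCost_le_of_reach {c : Config V} {k : ℕ} (h : Reach G M (start G) c k)
    (hc : IsFinished G c) : optimalCost G M ≤ k := by
  obtain ⟨l, hl, hr⟩ := h
  exact (iInf₂_le l ⟨c, hr, hc⟩).trans (Nat.cast_le.2 hl)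

end Pebbling

/-! ### Configurations and moves of the tiled multiplication -/

namespace ApproxAttention

open Pebbling

variable {n d : ℕ} {J : Set (Fin d → ℕ)} {M : ℕ}

/-- The entries of `Q`, `K`, `V`, `U₁` and `U₂`. -/
def Node.IsFactor : Node n d J → Prop
  | .Q _ _ | .K _ _ | .V _ _ | .U₁ _ _ | .U₂ _ _ => True
  | .prodH _ _ _ | .H _ _ | .prodO _ _ _ | .O _ _ => False

/-- The values of `H e k` and `O i k` into which the products for the rows in `T e k` and for the
columns in `D i k` have been aggregated. -/
noncomputable def accumulated (T : J → Fin d → Set (Fin n)) (D : Fin n → Fin d → Set J) :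
    Node n d J → Option (Set (Node n d J))
  | .H e k => partialValue ((fun i => .prodH i e k) '' T e k)
  | .O i k => partialValue ((fun e => .prodO i e k) '' D i k)
  | _ => none

open Classical in
/-- The content of a memory that holds the final values of the nodes in `X`, and accumulated values
of the entries of `H` and of the output. -/
noncomputable def content (X : Set (Node n d J)) (T : J → Fin d → Set (Fin n))
    (D : Fin n → Fin d → Set J) (v : Node n d J) : Option (Set (Node n d J)) :=
  if v ∈ X then some {u | (dag n d J).Adj u v} else accumulated T D v

/-- The configurations that occur in the tiled multiplication. -/
noncomputable def config (X : Set (Node n d J)) (T : J → Fin d → Set (Fin n))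
    (D : Fin n → Fin d → Set J) (Y : Set (Node n d J)) (D' : Fin n → Fin d → Set J) :
    Config (Node n d J) :=
  ⟨content X T D, content Y (fun _ _ => ∅) D'⟩

variable {X Y : Set (Node n d J)} {T T' : J → Fin d → Set (Fin n)}
  {D D' D₁ : Fin n → Fin d → Set J}

theorem content_of_mem {v : Node n d J} (h : v ∈ X) :
    content X T D v = some {u | (dag n d J).Adj u v} := if_pos h

theorem content_of_notMem {v : Node n d J} (h : v ∉ X) : content X T D v = accumulated T D v :=
  if_neg h

theorem accumulated_of_isFactor {v : Node n d J} (h : v.IsFactor) : accumulated T D v = none := by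
  cases v <;> first | rfl | exact h.elim

theorem isFinal_parents (G : Digraph (Node n d J)) (v : Node n d J) :
    IsFinal G v {u | G.Adj u v} := fun _ h => h

/-- Fast memory holds final factors, one tile of `H`, and partial outputs of a single row. -/
theorem redCount_config_le {x : ℕ} {E : Finset J} {F F' : Finset (Fin d)} {i : Fin n}
    (hX : X.encard ≤ x) (hT : ∀ e k, (T e k).Nonempty → e ∈ E ∧ k ∈ F)
    (hD : ∀ i' k, (D i' k).Nonempty → i' = i ∧ k ∈ F') :
    (config X T D Y D').redCount ≤ (x + E.card * F.card + F'.card : ℕ) := by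
  classical
  have hsub : {v | (config X T D Y D').fast v ≠ none} ⊆
      X ∪ ((E ×ˢ F).image (fun y => Node.H y.1 y.2) : Finset (Node n d J)) ∪
        (F'.image (fun k => Node.O i k) : Finset (Node n d J)) := by
    intro v hv
    by_cases hvX : v ∈ X
    · exact Or.inl (Or.inl hvX)
    have hv' : accumulated T D v ≠ none := by
      rw [← content_of_notMem hvX]; exact hv
    cases v with
    | H e k =>
      have := hT e k (Set.image_nonempty.1 (partialValue_ne_none.1 hv'))
      exact Or.inl (Or.inr (by simpa using this))
    | O i' k =>
      obtain ⟨rfl, hk⟩ := hD i' k (Set.image_nonempty.1 (partialValue_ne_none.1 hv'))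
      exact Or.inr (by simpa using hk)
    | _ => exact absurd rfl hv'
  refine (Set.encard_le_encard hsub).trans ((Set.encard_union_le _ _).trans ?_)
  rw [Nat.cast_add, Nat.cast_add]
  refine add_le_add ((Set.encard_union_le _ _).trans (add_le_add hX ?_)) ?_
  · rw [Set.encard_coe_eq_coe_finsetCard, ← Finset.card_product]
    exact Nat.cast_le.2 Finset.card_image_le
  · rw [Set.encard_coe_eq_coe_finsetCard]
    exact Nat.cast_le.2 Finset.card_image_le

theorem reach_load_factors (A : Finset (Node n d J)) (hA : ∀ v ∈ A, v ∈ Y)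
    (hcap : (config (X ∪ A) T D Y D').redCount ≤ M) :
    Reach (dag n d J) M (config X T D Y D') (config (X ∪ A) T D Y D') A.card := by
  classical
  have heq : (fun v => if v ∈ A then (config X T D Y D').slow v else (config X T D Y D').fast v) =
      content (X ∪ A) T D := by
    funext v
    by_cases hv : v ∈ A
    · rw [if_pos hv, content_of_mem (Or.inr hv)]
      exact content_of_mem (hA v hv)
    · rw [if_neg hv]
      simp [config, content, hv]
  have h := Reach.load_finset (G := dag n d J) (M := M) (config X T D Y D') A (fun v hv => by
    rw [show (config X T D Y D').slow v = _ from content_of_mem (hA v hv)]; simp)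
  rw [heq] at h
  exact h hcap

theorem reach_delete_factors (A : Finset (Node n d J)) (hA : ∀ v ∈ A, v.IsFactor)
    (hcap : (config X T D Y D').redCount ≤ M) :
    Reach (dag n d J) M (config X T D Y D') (config (X \ A) T D Y D') 0 := by
  classical
  have heq : (fun v => if v ∈ A then none else (config X T D Y D').fast v) =
      content (X \ A) T D := by
    funext v
    by_cases hv : v ∈ A
    · rw [if_pos hv, content_of_notMem (fun h => h.2 hv), accumulated_of_isFactor (hA v hv)]
    · simp [config, content, hv]
  have h := Reach.delete_finset (G := dag n d J) (config X T D Y D') A hcap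
  rw [heq] at h
  exact h

theorem reach_compute_factor {v : Node n d J} (hv : v.IsFactor) (hvX : v ∉ X)
    (P : Finset (Node n d J)) (hP : ∀ u, (dag n d J).Adj u v ↔ u ∈ P) (hne : P.Nonempty)
    (hPX : ∀ u ∈ P, u ∈ X) (hcap : (config (insert v X) T D Y D').redCount ≤ M) :
    Reach (dag n d J) M (config X T D Y D') (config (insert v X) T D Y D') 0 := by
  classical
  have heq : Function.update (config X T D Y D').fast v (some {u | (dag n d J).Adj u v}) =
      content (insert v X) T D := by
    funext w
    by_cases hw : w = v
    · subst hw; simp [content]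
    · simp [config, content, hw]
  have h := Reach.compute_node (G := dag n d J) (M := M) (config X T D Y D') v P hP hne
    ((content_of_notMem hvX).trans (accumulated_of_isFactor hv))
    (fun u hu => ⟨_, content_of_mem (hPX u ((hP u).1 hu)), isFinal_parents _ _⟩)
  rw [heq] at h
  exact h hcap

/-- The new table `T'` is described pointwise, so that loops can supply it as a closed formula in
the set of processed indices. -/
theorem reach_multiply_add_H (hX : ∀ v ∈ X, v.IsFactor) {i : Fin n} {e : J} {k : Fin d}
    (hU : .U₂ i e ∈ X) (hV : .V i k ∈ X) (hi : i ∉ T e k)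
    (hT₁ : T' e k = insert i (T e k)) (hT₂ : ∀ e' k', ¬ (e' = e ∧ k' = k) → T' e' k' = T e' k')
    (hcap : (config X T' D Y D').redCount + 1 ≤ M) :
    Reach (dag n d J) M (config X T D Y D') (config X T' D Y D') 0 := by
  classical
  have hH : content X T D (.H e k) = partialValue ((fun i => .prodH i e k) '' T e k) :=
    content_of_notMem (hX _)
  have heq : Function.update (config X T D Y D').fast (.H e k)
      (some (insert (.prodH i e k) (((config X T D Y D').fast (.H e k)).getD ∅))) =
      content X T' D := by
    funext w
    by_cases hw : w = .H e k
    · subst hw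
      rw [Function.update_self, show (config X T D Y D').fast = content X T D from rfl, hH,
        partialValue_getD, content_of_notMem (hX _)]
      simp only [accumulated]
      rw [hT₁, Set.image_insert_eq, partialValue_of_nonempty (Set.insert_nonempty _ _)]
    · rw [Function.update_of_ne hw]
      simp only [config, content]
      congr 1
      cases w with
      | H e' k' =>
        simp only [accumulated]
        rw [hT₂ e' k' (by rintro ⟨rfl, rfl⟩; exact hw rfl)]
      | _ => rfl
  have h := Reach.multiply_add (G := dag n d J) (M := M) (config X T D Y D') (a := .U₂ i e)
    (b := .V i k) (p := .prodH i e k) (t := .H e k)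
    (content_of_mem hU) (isFinal_parents _ _) (content_of_mem hV) (isFinal_parents _ _)
    (by simp) (Edge.U₂_prodH i e k) (Edge.V_prodH i e k)
    (fun u hu => by cases hu <;> simp) (Edge.prodH_H i e k) (by simp) (content_of_notMem (hX _))
    (by rw [show (config X T D Y D').fast = content X T D from rfl, hH]; simpa using hi)
  rw [heq] at h
  exact h hcap

theorem reach_multiply_add_O (hX : ∀ v ∈ X, v.IsFactor) (hn : 1 ≤ n) {i : Fin n} {e : J}
    {k : Fin d} (hU : .U₁ i e ∈ X) (hTu : T e k = Set.univ) (he : e ∉ D i k)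
    (hD₁ : D₁ i k = insert e (D i k)) (hD₂ : ∀ i' k', ¬ (i' = i ∧ k' = k) → D₁ i' k' = D i' k')
    (hcap : (config X T D₁ Y D').redCount + 1 ≤ M) :
    Reach (dag n d J) M (config X T D Y D') (config X T D₁ Y D') 0 := by
  classical
  have hO : content X T D (.O i k) = partialValue ((fun e => .prodO i e k) '' D i k) :=
    content_of_notMem (hX _)
  -- All rows have been aggregated, so the entry of `H` is final. With no rows `partialValue` would
  -- be `none`, hence `1 ≤ n`.
  have hH : content X T D (.H e k) = some ((fun i => .prodH i e k) '' Set.univ) := by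
    have : Nonempty (Fin n) := ⟨⟨0, hn⟩⟩
    rw [← partialValue_of_nonempty (Set.univ_nonempty.image _), ← hTu]
    exact content_of_notMem (hX _)
  have heq : Function.update (config X T D Y D').fast (.O i k)
      (some (insert (.prodO i e k) (((config X T D Y D').fast (.O i k)).getD ∅))) =
      content X T D₁ := by
    funext w
    by_cases hw : w = .O i k
    · subst hw
      rw [Function.update_self, show (config X T D Y D').fast = content X T D from rfl, hO,
        partialValue_getD, content_of_notMem (hX _)]
      simp only [accumulated]
      rw [hD₁, Set.image_insert_eq, partialValue_of_nonempty (Set.insert_nonempty _ _)]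
    · rw [Function.update_of_ne hw]
      simp only [config, content]
      congr 1
      cases w with
      | O i' k' =>
        simp only [accumulated]
        rw [hD₂ i' k' (by rintro ⟨rfl, rfl⟩; exact hw rfl)]
      | _ => rfl
  have h := Reach.multiply_add (G := dag n d J) (M := M) (config X T D Y D') (a := .U₁ i e)
    (b := .H e k) (p := .prodO i e k) (t := .O i k)
    (content_of_mem hU) (isFinal_parents _ _) hH
    (fun u hu => by cases hu with | prodH_H j => exact ⟨j, trivial, rfl⟩)
    (by simp) (Edge.U₁_prodO i e k) (Edge.H_prodO i e k)
    (fun u hu => by cases hu <;> simp) (Edge.prodO_O i e k) (by simp) (content_of_notMem (hX _))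
    (by rw [show (config X T D Y D').fast = content X T D from rfl, hO]; simpa using he)
  rw [heq] at h
  exact h hcap

/-- Loading the parts of the output that belong to row `i` and to the columns in `F`. -/
theorem reach_load_O (hX : ∀ v ∈ X, v.IsFactor) (hY : ∀ v ∈ Y, v.IsFactor) (i : Fin n)
    (F : Finset (Fin d)) (hD₁ : ∀ k ∈ F, D₁ i k = D' i k)
    (hD₂ : ∀ i' k', ¬ (i' = i ∧ k' ∈ F) → D₁ i' k' = ∅)
    (hcap : (config X T D₁ Y D').redCount ≤ M) :
    Reach (dag n d J) M (config X T (fun _ _ => ∅) Y D') (config X T D₁ Y D') F.card := by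
  classical
  -- Outputs that have received nothing have no blue pebble; they are skipped and started from
  -- scratch later.
  set A := (F.filter fun k => (D' i k).Nonempty).image fun k => Node.O (J := J) i k with hA
  have hO : ∀ k, content Y (fun _ _ => ∅) D' (.O i k) =
      partialValue ((fun e => .prodO i e k) '' D' i k) := fun k => content_of_notMem (hY _)
  have hO' : ∀ D i k, content X T D (.O i k) =
      partialValue ((fun e => .prodO i e k) '' D i k) := fun D i k => content_of_notMem (hX _)
  have heq : (fun v => if v ∈ A then (config X T (fun _ _ => ∅) Y D').slow v
      else (config X T (fun _ _ => ∅) Y D').fast v) = content X T D₁ := by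
    funext v
    by_cases hv : v ∈ A
    · rw [if_pos hv]
      obtain ⟨k, hk, rfl⟩ := Finset.mem_image.1 hv
      exact (hO k).trans (by rw [hO', hD₁ k (Finset.mem_filter.1 hk).1])
    · rw [if_neg hv]
      show content X T (fun _ _ => ∅) v = content X T D₁ v
      cases v with
      | O i' k =>
        rw [hO', hO']
        by_cases hik : i' = i ∧ k ∈ F
        · obtain ⟨rfl, hk⟩ := hik
          have : ¬ (D' i' k).Nonempty := fun h => hv
            (Finset.mem_image_of_mem _ (Finset.mem_filter.2 ⟨hk, h⟩))
          rw [hD₁ k hk, Set.not_nonempty_iff_eq_empty.1 this]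
        · rw [hD₂ _ _ hik]
      | _ => simp only [content, accumulated]
  have h := Reach.load_finset (G := dag n d J) (M := M) (config X T (fun _ _ => ∅) Y D') A
    (fun v hv => by
      obtain ⟨k, hk, rfl⟩ := Finset.mem_image.1 hv
      rw [show (config X T (fun _ _ => ∅) Y D').slow (.O i k) = _ from hO k]
      exact partialValue_ne_none.2 (Set.image_nonempty.2 (Finset.mem_filter.1 hk).2))
  rw [heq] at h
  exact (h hcap).mono (Finset.card_image_le.trans (Finset.card_filter_le _ _))

/-- Saving the parts of the output that belong to row `i` and to the columns in `F`. -/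
theorem reach_save_O (hX : ∀ v ∈ X, v.IsFactor) (hY : ∀ v ∈ Y, v.IsFactor) (i : Fin n)
    (F : Finset (Fin d)) (hD : ∀ k ∈ F, D' i k ⊆ D i k) (hD₁ : ∀ k ∈ F, D₁ i k = D i k)
    (hD₂ : ∀ i' k', ¬ (i' = i ∧ k' ∈ F) → D₁ i' k' = D' i' k')
    (hcap : (config X T D Y D').redCount ≤ M) :
    Reach (dag n d J) M (config X T D Y D') (config X T D Y D₁) F.card := by
  classical
  set A := (F.filter fun k => (D i k).Nonempty).image fun k => Node.O (J := J) i k with hA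
  have hO : ∀ D i k, content Y (fun _ _ => ∅) D (.O i k) =
      partialValue ((fun e => .prodO i e k) '' D i k) := fun D i k => content_of_notMem (hY _)
  have hO' : ∀ D i k, content X T D (.O i k) =
      partialValue ((fun e => .prodO i e k) '' D i k) := fun D i k => content_of_notMem (hX _)
  have heq : (fun v => if v ∈ A then (config X T D Y D').fast v
      else (config X T D Y D').slow v) = content Y (fun _ _ => ∅) D₁ := by
    funext v
    by_cases hv : v ∈ A
    · rw [if_pos hv]
      obtain ⟨k, hk, rfl⟩ := Finset.mem_image.1 hv
      exact (hO' D i k).trans (by rw [hO, hD₁ k (Finset.mem_filter.1 hk).1])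
    · rw [if_neg hv]
      show content Y (fun _ _ => ∅) D' v = content Y (fun _ _ => ∅) D₁ v
      cases v with
      | O i' k =>
        rw [hO, hO]
        by_cases hik : i' = i ∧ k ∈ F
        · obtain ⟨rfl, hk⟩ := hik
          have : ¬ (D i' k).Nonempty := fun h => hv
            (Finset.mem_image_of_mem _ (Finset.mem_filter.2 ⟨hk, h⟩))
          have hDe := Set.not_nonempty_iff_eq_empty.1 this
          -- For skipped outputs the slow copy must be empty as well; this is where `D' i k ⊆ D i k`
          -- enters.
          have hDe' : D' i' k = ∅ := Set.subset_empty_iff.1 (by rw [← hDe]; exact hD k hk)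
          rw [hD₁ k hk, hDe, hDe']
        · rw [hD₂ _ _ hik]
      | _ => simp only [content, accumulated]
  have h := Reach.save_finset (G := dag n d J) (M := M) (config X T D Y D') A
    (fun v hv => by
      obtain ⟨k, hk, rfl⟩ := Finset.mem_image.1 hv
      rw [show (config X T D Y D').fast (.O i k) = _ from hO' D i k]
      exact partialValue_ne_none.2 (Set.image_nonempty.2 (Finset.mem_filter.1 hk).2)) hcap
  rw [heq] at h
  exact h.mono (Finset.card_image_le.trans (Finset.card_filter_le _ _))

theorem reach_delete_O (hX : ∀ v ∈ X, v.IsFactor) (i : Fin n) (F : Finset (Fin d))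
    (hD : ∀ i' k', ¬ (i' = i ∧ k' ∈ F) → D i' k' = ∅)
    (hcap : (config X T D Y D').redCount ≤ M) :
    Reach (dag n d J) M (config X T D Y D') (config X T (fun _ _ => ∅) Y D') 0 := by
  classical
  have heq : (fun v => if v ∈ F.image (fun k => Node.O i k) then none else
      (config X T D Y D').fast v) = content X T (fun _ _ => ∅) := by
    funext v
    by_cases hv : v ∈ F.image (fun k => Node.O i k)
    · rw [if_pos hv]
      obtain ⟨k, hk, rfl⟩ := Finset.mem_image.1 hv
      rw [content_of_notMem (hX _)]
      simp [accumulated]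
    · rw [if_neg hv]
      simp only [config, content]
      congr 1
      cases v with
      | O i' k =>
        simp only [accumulated]
        rw [hD i' k (by rintro ⟨rfl, hk⟩; exact hv (Finset.mem_image_of_mem _ hk))]
      | _ => rfl
  have h := Reach.delete_finset (G := dag n d J) (config X T D Y D')
    (F.image (fun k => Node.O i k)) hcap
  rw [heq] at h
  exact h

theorem reach_delete_H (hX : ∀ v ∈ X, v.IsFactor) (E : Finset J) (F : Finset (Fin d))
    (hT : ∀ e k, ¬ (e ∈ E ∧ k ∈ F) → T e k = ∅)
    (hcap : (config X T D Y D').redCount ≤ M) :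
    Reach (dag n d J) M (config X T D Y D') (config X (fun _ _ => ∅) D Y D') 0 := by
  classical
  have heq : (fun v => if v ∈ (E ×ˢ F).image (fun x => Node.H x.1 x.2) then none else
      (config X T D Y D').fast v) = content X (fun _ _ => ∅) D := by
    funext v
    by_cases hv : v ∈ (E ×ˢ F).image (fun x => Node.H x.1 x.2)
    · rw [if_pos hv]
      obtain ⟨k, hk, rfl⟩ := Finset.mem_image.1 hv
      rw [content_of_notMem (hX _)]
      simp [accumulated]
    · rw [if_neg hv]
      simp only [config, content]
      congr 1
      cases v with
      | H e k =>
        simp only [accumulated]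
        rw [hT e k (fun hk => hv (Finset.mem_image.2 ⟨(e, k), Finset.mem_product.2 hk, rfl⟩))]
      | _ => rfl
  have h := Reach.delete_finset (G := dag n d J) (config X T D Y D')
    ((E ×ˢ F).image (fun x => Node.H x.1 x.2)) hcap
  rw [heq] at h
  exact h

end ApproxAttention

/-! ### Processing one tile, and the multiplication by tiles -/

namespace ApproxAttention

open Pebbling

variable {n d : ℕ} {J : Set (Fin d → ℕ)} {M : ℕ}

/-- The monomial `e` is not constant and can be evaluated from the variables in `s`. -/
def Evaluable (s : Finset (Fin d)) (e : J) : Prop :=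
  (∃ k, e.1 k ≠ 0) ∧ ∀ k, e.1 k ≠ 0 → k ∈ s

variable {X Y : Set (Node n d J)} {T T' : J → Fin d → Set (Fin n)}
  {D D' D₁ : Fin n → Fin d → Set J}

-- An evaluable factor is recomputed for free from the variables in fast memory; any other is loaded
-- at cost one. Constant monomials have no parents, so they are sources and must be loaded.
open Classical in
theorem reach_obtain_factor {s : Finset (Fin d)} {src : Fin d → Node n d J} {v : Node n d J} {e : J}
    (hv : v.IsFactor) (hvX : v ∉ X) (hpar : ∀ u, (dag n d J).Adj u v ↔ ∃ k, e.1 k ≠ 0 ∧ src k = u)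
    (hs : ∀ k ∈ s, src k ∈ X) (hY : ¬ Evaluable s e → v ∈ Y)
    (hcap : (config (insert v X) T D Y D').redCount ≤ M) :
    Reach (dag n d J) M (config X T D Y D') (config (insert v X) T D Y D')
      (if Evaluable s e then 0 else 1) := by
  split_ifs with h
  · refine reach_compute_factor hv hvX ((Finset.univ.filter fun k => e.1 k ≠ 0).image src) ?_ ?_ ?_
      hcap
    · intro u
      rw [hpar]
      simp
    · obtain ⟨k, hk⟩ := h.1
      exact ⟨src k, Finset.mem_image_of_mem _ (by simpa using hk)⟩
    · intro u hu
      obtain ⟨k, hk, rfl⟩ := Finset.mem_image.1 hu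
      exact hs k (h.2 k (by simpa using hk))
  · have := reach_load_factors (X := X) (Y := Y) (T := T) (D := D) (D' := D') (M := M) {v}
      (by simpa using hY h) (by simpa using hcap)
    simpa using this

open Classical in
/-- The factors `v e` are obtained one after the other. While `v e` is in fast memory, it is
combined with one further factor for each column in `F`. -/
theorem reach_loop_factors {s : Finset (Fin d)} {src : Fin d → Node n d J} {v : J → Node n d J}
    (E : Finset J) (F : Finset (Fin d))
    (T : Finset J → J → Fin d → Set (Fin n)) (D : Finset J → Fin n → Fin d → Set J)
    (T' : Finset J → J → Finset (Fin d) → J → Fin d → Set (Fin n))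
    (D₁ : Finset J → J → Finset (Fin d) → Fin n → Fin d → Set J)
    (hv : ∀ e, (v e).IsFactor) (hvX : ∀ e, v e ∉ X)
    (hpar : ∀ e u, (dag n d J).Adj u (v e) ↔ ∃ k, e.1 k ≠ 0 ∧ src k = u)
    (hs : ∀ k ∈ s, src k ∈ X) (hY : ∀ e ∈ E, ¬ Evaluable s e → v e ∈ Y)
    (hT₀ : ∀ S e, T' S e ∅ = T S) (hD₀ : ∀ S e, D₁ S e ∅ = D S)
    (hT₁ : ∀ S e, T' S e F = T (insert e S)) (hD₁ : ∀ S e, D₁ S e F = D (insert e S))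
    (hstep : ∀ S ⊆ E, ∀ e ∈ E, e ∉ S → ∀ F' ⊆ F, ∀ k ∈ F, k ∉ F' →
      Reach (dag n d J) M (config (insert (v e) X) (T' S e F') (D₁ S e F') Y D')
        (config (insert (v e) X) (T' S e (insert k F')) (D₁ S e (insert k F')) Y D') 0)
    (hcap : ∀ S e, (config (insert (v e) X) (T S) (D S) Y D').redCount ≤ M) :
    Reach (dag n d J) M (config X (T ∅) (D ∅) Y D') (config X (T E) (D E) Y D')
      (E.filter fun e => ¬ Evaluable s e).card := by
  -- `T S` and `D S` describe the state when the columns in `S` are finished; `T' S e F'` and `D₁ S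
  -- e F'` describe it when, in addition, column `e` has been combined with `F'`.
  have key := Reach.loop (G := dag n d J) (M := M) E (fun S => config X (T S) (D S) Y D')
    (fun e => if Evaluable s e then 0 else 1) ?_
  · refine key.mono (le_of_eq ?_)
    rw [Finset.card_filter]
    exact Finset.sum_congr rfl fun e _ => by by_cases h : Evaluable s e <;> simp [h]
  intro S hS e he heS
  have h1 := reach_obtain_factor (T := T S) (D := D S) (D' := D') (hv e) (hvX e) (hpar e) hs
    (hY e he) (hcap S e)
  have h2 := Reach.loop_const (G := dag n d J) (M := M) F
    (fun F' => config (insert (v e) X) (T' S e F') (D₁ S e F') Y D') 0 (hstep S hS e he heS)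
  simp only [hT₀, hD₀, hT₁, hD₁] at h2
  have h3 := reach_delete_factors (X := insert (v e) X) (Y := Y) (T := T (insert e S))
    (D := D (insert e S)) (D' := D') (M := M) {v e} (by simpa using hv e) (hcap _ e)
  have h4 : insert (v e) X \ (({v e} : Finset (Node n d J)) : Set (Node n d J)) = X := by
    rw [Finset.coe_singleton]
    exact Set.insert_sdiff_self_of_notMem (hvX e)
  rw [h4] at h3
  simpa using (h1.trans h2).trans h3

open Classical in
/-- The rows in `R` have been aggregated into the tile `E × F` of `H`. -/
def tile (E : Finset J) (F : Finset (Fin d)) (R : Set (Fin n)) (e : J) (k : Fin d) : Set (Fin n) :=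
  if e ∈ E ∧ k ∈ F then R else ∅

theorem tile_nonempty {E : Finset J} {F : Finset (Fin d)} {R : Set (Fin n)} {e : J} {k : Fin d}
    (h : (tile E F R e k).Nonempty) : e ∈ E ∧ k ∈ F := by
  unfold tile at h
  split_ifs at h with h'
  · exact h'
  · exact absurd h Set.not_nonempty_empty

variable {E : Finset J} {F s : Finset (Fin d)}

-- The entries of row `i` of `K` in `s` and of `V` in `F` are loaded once and serve the whole tile.
-- Besides these and the tile, memory is needed for one entry of `U₂` and one product: this is the
-- `+ 2`.
open Classical in
theorem reach_row_H (hsrc : ∀ i k, .K i k ∈ Y) (hsrc' : ∀ i k, .V i k ∈ Y)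
    (hY : ∀ e ∈ E, ¬ Evaluable s e → ∀ i, .U₂ i e ∈ Y)
    (hM : E.card * F.card + s.card + F.card + 2 ≤ M) {R : Finset (Fin n)} {i : Fin n} (hi : i ∉ R) :
    Reach (dag n d J) M (config ∅ (tile E F R) (fun _ _ => ∅) Y D')
      (config ∅ (tile E F (insert i R : Finset (Fin n))) (fun _ _ => ∅) Y D')
      (s.card + F.card + (E.filter fun e => ¬ Evaluable s e).card) := by
  set A : Finset (Node n d J) := s.image (.K i) ∪ F.image (.V i) with hA
  have hAc : A.card ≤ s.card + F.card :=
    (Finset.card_union_le _ _).trans (add_le_add Finset.card_image_le Finset.card_image_le)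
  have hAf : ∀ v ∈ A, v.IsFactor := by
    intro v hv
    rcases Finset.mem_union.1 hv with hv | hv <;> obtain ⟨k, -, rfl⟩ := Finset.mem_image.1 hv <;>
      trivial
  have hAY : ∀ v ∈ A, v ∈ Y := by
    intro v hv
    rcases Finset.mem_union.1 hv with hv | hv <;> obtain ⟨k, -, rfl⟩ := Finset.mem_image.1 hv
    · exact hsrc i k
    · exact hsrc' i k
  have hAe : (A : Set (Node n d J)).encard ≤ (s.card + F.card : ℕ) := by
    rw [Set.encard_coe_eq_coe_finsetCard]; exact Nat.cast_le.2 hAc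
  have hUA : ∀ e, Node.U₂ i e ∉ (A : Set (Node n d J)) := by
    intro e he
    simp [hA] at he
  have cap : ∀ (X : Set (Node n d J)) (T : J → Fin d → Set (Fin n)),
      X.encard ≤ (s.card + F.card + 1 : ℕ) → (∀ e k, (T e k).Nonempty → e ∈ E ∧ k ∈ F) →
      (config X T (fun _ _ => ∅) Y D').redCount + 1 ≤ M := by
    intro X T hX hT
    have := redCount_config_le (D := fun _ _ => ∅) (Y := Y) (D' := D') (F' := ∅) (i := i) hX hT
      (by simp)
    calc _ ≤ ((s.card + F.card + 1 + E.card * F.card + (∅ : Finset (Fin d)).card : ℕ) : ℕ∞) + 1 :=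
          add_le_add_left this _
      _ ≤ M := by
          rw [Finset.card_empty]
          exact_mod_cast (by omega : s.card + F.card + 1 + E.card * F.card + 0 + 1 ≤ M)
  have cap' : ∀ (X : Set (Node n d J)) (T : J → Fin d → Set (Fin n)),
      X.encard ≤ (s.card + F.card + 1 : ℕ) → (∀ e k, (T e k).Nonempty → e ∈ E ∧ k ∈ F) →
      (config X T (fun _ _ => ∅) Y D').redCount ≤ M :=
    fun X T hX hT => le_self_add.trans (cap X T hX hT)
  have hAe' : (A : Set (Node n d J)).encard ≤ (s.card + F.card + 1 : ℕ) :=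
    hAe.trans (Nat.cast_le.2 (Nat.le_succ _))
  have hAi : ∀ v, (insert v (A : Set (Node n d J))).encard ≤ (s.card + F.card + 1 : ℕ) := by
    intro v
    refine (Set.encard_insert_le _ _).trans ?_
    rw [Nat.cast_add _ 1]
    exact add_le_add_left hAe _
  have h1 := reach_load_factors (X := ∅) (Y := Y) (T := tile E F R) (D := fun _ _ => ∅) (D' := D')
    (M := M) A hAY (by rw [Set.empty_union]; exact cap' _ _ hAe' fun _ _ => tile_nonempty)
  rw [Set.empty_union] at h1
  have h2 := reach_loop_factors (X := (A : Set (Node n d J))) (Y := Y) (M := M) (s := s)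
    (src := .K i) (v := .U₂ i) (D' := D') E F
    (fun S e k => if e ∈ E ∧ k ∈ F then (if e ∈ S then insert i (R : Set (Fin n)) else R) else ∅)
    (fun _ _ _ => ∅)
    (fun S e F' e' k => if e' ∈ E ∧ k ∈ F then
      (if e' ∈ S ∨ e' = e ∧ k ∈ F' then insert i (R : Set (Fin n)) else R) else ∅)
    (fun _ _ _ _ _ => ∅) (fun _ => trivial) hUA
    (by
      intro e u
      constructor
      · intro h
        cases h with | K_U₂ i k e h => exact ⟨k, h, rfl⟩
      · rintro ⟨k, hk, rfl⟩
        exact Edge.K_U₂ i k e hk)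
    (fun k hk => by simp [hA, hk]) (fun e he h => hY e he h i)
    (fun S e => by simp) (fun _ _ => rfl)
    (fun S e => by
      funext e' k
      by_cases h : e' ∈ E ∧ k ∈ F
      · simp only [h, and_true, if_true, Finset.mem_insert, or_comm]
      · simp only [h, if_false])
    (fun _ _ => rfl)
    (by
      intro S hS e he heS F' hF' k hk hkF'
      refine reach_multiply_add_H (i := i) (e := e) (k := k) ?_ (Or.inl rfl)
        (Or.inr (by simp [hA, hk])) ?_ ?_ ?_ (cap _ _ (hAi _) ?_)
      · rintro v (rfl | hv)
        · trivial
        · exact hAf v hv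
      · simp [he, hk, heS, hkF', hi]
      · simp [he, hk, heS, hkF']
      · intro e' k' hne
        by_cases h : e' ∈ E ∧ k' ∈ F
        · simp only [h, and_true, if_true]
          congr 1
          simp only [Finset.mem_insert, eq_iff_iff]
          tauto
        · simp only [h, if_false]
      · intro e' k' h
        by_contra hne
        simp [hne] at h)
    (by
      intro S e
      refine cap' _ _ (hAi _) ?_
      intro e' k' h
      by_contra hne
      simp [hne] at h)
  have h3 := reach_delete_factors (X := (A : Set (Node n d J))) (Y := Y)
    (T := tile E F (insert i R : Finset (Fin n))) (D := fun _ _ => ∅) (D' := D') (M := M) A hAf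
    (cap' _ _ hAe' fun _ _ => tile_nonempty)
  rw [Set.sdiff_self] at h3
  have e1 : (fun e k => if e ∈ E ∧ k ∈ F then
      (if e ∈ (∅ : Finset J) then insert i (R : Set (Fin n)) else R) else ∅) = tile E F R := by
    funext e k; simp [tile]
  have e2 : (fun e k => if e ∈ E ∧ k ∈ F then
      (if e ∈ E then insert i (R : Set (Fin n)) else R) else ∅) =
      tile E F (insert i R : Finset (Fin n)) := by
    funext e k
    by_cases h : e ∈ E ∧ k ∈ F
    · simp [tile, h]
    · simp [tile, h]
  rw [e1, e2] at h2
  exact ((h1.trans h2).trans h3).mono (by omega)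

-- The term `2 * F.card` pays for loading and saving the partial outputs of row `i`; they occupy the
-- space that the entries of `V` take in `reach_row_H`.
open Classical in
theorem reach_row_O (hn : 1 ≤ n) (hYf : ∀ v ∈ Y, v.IsFactor) (hsrc : ∀ i k, .Q i k ∈ Y)
    (hY : ∀ e ∈ E, ¬ Evaluable s e → ∀ i, .U₁ i e ∈ Y)
    (hM : E.card * F.card + s.card + F.card + 2 ≤ M) {i : Fin n}
    (hdisj : ∀ k ∈ F, Disjoint (D' i k) E)
    (hD₁ : ∀ i' k, D₁ i' k = if i' = i ∧ k ∈ F then D' i' k ∪ E else D' i' k) :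
    Reach (dag n d J) M (config ∅ (tile E F Set.univ) (fun _ _ => ∅) Y D')
      (config ∅ (tile E F Set.univ) (fun _ _ => ∅) Y D₁)
      (s.card + 2 * F.card + (E.filter fun e => ¬ Evaluable s e).card) := by
  set A : Finset (Node n d J) := s.image (.Q i) with hA
  have hAc : A.card ≤ s.card := Finset.card_image_le
  have hAf : ∀ v ∈ A, v.IsFactor := by
    intro v hv
    obtain ⟨k, -, rfl⟩ := Finset.mem_image.1 hv
    trivial
  have hAY : ∀ v ∈ A, v ∈ Y := by
    intro v hv
    obtain ⟨k, -, rfl⟩ := Finset.mem_image.1 hv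
    exact hsrc i k
  have hAe : (A : Set (Node n d J)).encard ≤ (s.card : ℕ) := by
    rw [Set.encard_coe_eq_coe_finsetCard]; exact Nat.cast_le.2 hAc
  have hUA : ∀ e, Node.U₁ i e ∉ (A : Set (Node n d J)) := by
    intro e he
    simp [hA] at he
  have cap : ∀ (X : Set (Node n d J)) (D D' : Fin n → Fin d → Set J),
      X.encard ≤ (s.card + 1 : ℕ) → (∀ i' k, (D i' k).Nonempty → i' = i ∧ k ∈ F) →
      (config X (tile E F Set.univ) D Y D').redCount + 1 ≤ M := by
    intro X D D' hX hD
    have := redCount_config_le (T := tile E F (Set.univ : Set (Fin n))) (Y := Y) (D' := D') hX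
      (fun _ _ => tile_nonempty) hD
    calc _ ≤ ((s.card + 1 + E.card * F.card + F.card : ℕ) : ℕ∞) + 1 := add_le_add_left this _
      _ ≤ M := by exact_mod_cast (by omega : s.card + 1 + E.card * F.card + F.card + 1 ≤ M)
  have cap' : ∀ (X : Set (Node n d J)) (D D' : Fin n → Fin d → Set J),
      X.encard ≤ (s.card + 1 : ℕ) → (∀ i' k, (D i' k).Nonempty → i' = i ∧ k ∈ F) →
      (config X (tile E F Set.univ) D Y D').redCount ≤ M :=
    fun X D D' hX hT => le_self_add.trans (cap X D D' hX hT)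
  have hAe' : (A : Set (Node n d J)).encard ≤ (s.card + 1 : ℕ) :=
    hAe.trans (Nat.cast_le.2 (Nat.le_succ _))
  have hAi : ∀ v, (insert v (A : Set (Node n d J))).encard ≤ (s.card + 1 : ℕ) := by
    intro v
    refine (Set.encard_insert_le _ _).trans ?_
    rw [Nat.cast_add _ 1]
    exact add_le_add_left hAe _
  -- The fast copies of the outputs in row `i` once the columns in `S` are added; the slow copies
  -- remain at `D'` until they are saved.
  set DS : Finset J → Fin n → Fin d → Set J :=
    fun S i' k => if i' = i ∧ k ∈ F then D' i' k ∪ S else ∅ with hDS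
  have hDSne : ∀ S i' k, (DS S i' k).Nonempty → i' = i ∧ k ∈ F := by
    intro S i' k h
    by_contra hne
    simp [hDS, hne] at h
  have h0 := reach_load_factors (X := ∅) (Y := Y) (T := tile E F Set.univ) (D := fun _ _ => ∅)
    (D' := D') (M := M) A hAY (by
      rw [Set.empty_union]
      exact cap' _ _ _ hAe' fun i' k h => absurd h Set.not_nonempty_empty)
  rw [Set.empty_union] at h0
  have h1 := reach_load_O (X := (A : Set (Node n d J))) (Y := Y) (T := tile E F Set.univ)
    (D₁ := DS ∅) (D' := D') (M := M) hAf hYf i F (fun k hk => by simp [hDS, hk])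
    (fun i' k' h => by simp [hDS, h]) (cap' _ _ _ hAe' (hDSne _))
  have h2 := reach_loop_factors (X := (A : Set (Node n d J))) (Y := Y) (M := M) (s := s)
    (src := .Q i) (v := .U₁ i) (D' := D') E F (fun _ => tile E F Set.univ) DS
    (fun _ _ _ => tile E F Set.univ)
    (fun S e F' i' k => if i' = i ∧ k ∈ F then
      D' i' k ∪ (if k ∈ F' then insert e (S : Set J) else S) else ∅)
    (fun _ => trivial) hUA
    (by
      intro e u
      constructor
      · intro h
        cases h with | Q_U₁ i k e h => exact ⟨k, h, rfl⟩
      · rintro ⟨k, hk, rfl⟩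
        exact Edge.Q_U₁ i k e hk)
    (fun k hk => by simp [hA, hk]) (fun e he h => hY e he h i)
    (fun _ _ => rfl) (fun S e => by simp [hDS]) (fun _ _ => rfl)
    (fun S e => by
      funext i' k
      by_cases h : i' = i ∧ k ∈ F
      · simp [hDS, h]
      · simp only [hDS, h, if_false])
    (by
      intro S hS e he heS F' hF' k hk hkF'
      refine reach_multiply_add_O (i := i) (e := e) (k := k) ?_ hn (Or.inl rfl)
        (by simp [tile, he, hk]) ?_ ?_ ?_ (cap _ _ _ (hAi _) ?_)
      · rintro v (rfl | hv)
        · trivial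
        · exact hAf v hv
      · have : e ∉ D' i k := fun h => Set.disjoint_left.1 (hdisj k hk) h he
        simp [hk, heS, hkF', this]
      · simp [hk, hkF', Set.union_insert]
      · intro i' k' hne
        by_cases h : i' = i ∧ k' ∈ F
        · have : k' ≠ k := fun h' => hne ⟨h.1, h'⟩
          simp [h, this]
        · simp only [h, if_false]
      · intro i' k' h
        by_contra hne
        simp [hne] at h)
    (fun S e => cap' _ _ _ (hAi _) (hDSne _))
  have h3 := reach_delete_factors (X := (A : Set (Node n d J))) (Y := Y)
    (T := tile E F Set.univ) (D := DS E) (D' := D') (M := M) A hAf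
    (cap' _ _ _ hAe' (hDSne _))
  rw [Set.sdiff_self] at h3
  have hcap0 : (∅ : Set (Node n d J)).encard ≤ (s.card + 1 : ℕ) := by simp
  have h4 := reach_save_O (X := (∅ : Set (Node n d J))) (Y := Y) (T := tile E F Set.univ)
    (D := DS E) (D' := D') (D₁ := D₁) (M := M) (fun v hv => hv.elim) hYf i F
    (fun k hk => by simp [hDS, hk]) (fun k hk => by simp [hD₁, hDS, hk])
    (fun i' k' h => by simp only [hD₁, h, if_false]) (cap' _ _ _ hcap0 (hDSne _))
  have h5 := reach_delete_O (X := (∅ : Set (Node n d J))) (Y := Y) (T := tile E F Set.univ)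
    (D := DS E) (D' := D₁) (M := M) (fun v hv => hv.elim) i F
    (fun i' k' h => by simp only [hDS, h, if_false]) (cap' _ _ _ hcap0 (hDSne _))
  exact (((((h0.trans h1).trans h2).trans h3).trans h4).trans h5).mono (by omega)

open Classical in
/-- Processing a tile `E × F` of `H`, which is kept in fast memory until it is used up. -/
theorem reach_tile (hn : 1 ≤ n) (hYf : ∀ v ∈ Y, v.IsFactor) (hQ : ∀ i k, .Q i k ∈ Y)
    (hK : ∀ i k, .K i k ∈ Y) (hV : ∀ i k, .V i k ∈ Y)
    (hY : ∀ e ∈ E, ¬ Evaluable s e → ∀ i, .U₁ i e ∈ Y ∧ .U₂ i e ∈ Y)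
    (hM : E.card * F.card + s.card + F.card + 2 ≤ M)
    (hdisj : ∀ i, ∀ k ∈ F, Disjoint (D' i k) E)
    (hD₁ : ∀ i k, D₁ i k = if k ∈ F then D' i k ∪ E else D' i k) :
    Reach (dag n d J) M (config ∅ (fun _ _ => ∅) (fun _ _ => ∅) Y D')
      (config ∅ (fun _ _ => ∅) (fun _ _ => ∅) Y D₁)
      (n * (2 * s.card + 3 * F.card + 2 * (E.filter fun e => ¬ Evaluable s e).card)) := by
  have h1 := Reach.loop_const (G := dag n d J) (M := M) (Finset.univ : Finset (Fin n))
    (fun R => config ∅ (tile E F (R : Set (Fin n))) (fun _ _ => ∅) Y D') _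
    (fun R _ i _ hi => reach_row_H hK hV (fun e he h i => (hY e he h i).2) hM hi)
  have h2 := Reach.loop_const (G := dag n d J) (M := M) (Finset.univ : Finset (Fin n))
    (fun R => config ∅ (tile E F Set.univ) (fun _ _ => ∅) Y
      (fun i k => if i ∈ R ∧ k ∈ F then D' i k ∪ E else D' i k)) _
    (fun R _ i _ hi => reach_row_O (s := s) (i := i) hn hYf hQ (fun e he h i => (hY e he h i).1) hM
      (by intro k hk; simpa [hi] using hdisj i k hk)
      (by
        intro i' k
        by_cases hii : i' = i
        · subst hii
          by_cases hk : k ∈ F <;> simp [hi, hk]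
        · simp [hii]))
  have h3 := reach_delete_H (X := (∅ : Set (Node n d J))) (Y := Y)
    (T := tile E F (Set.univ : Set (Fin n))) (D := fun _ _ => ∅) (D' := D₁) (M := M)
    (fun v hv => hv.elim) E F (fun e k h => by simp [tile, h]) (by
      have := redCount_config_le (T := tile E F (Set.univ : Set (Fin n))) (Y := Y) (D' := D₁)
        (D := fun _ _ => ∅) (X := ∅) (x := 0) (F' := ∅) (i := ⟨0, hn⟩) (by simp)
        (fun _ _ => tile_nonempty) (by simp)
      refine this.trans (Nat.cast_le.2 ?_)
      rw [Finset.card_empty]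
      omega)
  have e1 : tile E F ((∅ : Finset (Fin n)) : Set (Fin n)) = fun _ _ => ∅ := by
    funext e k; simp [tile]
  have e2 : (fun i k => if i ∈ (Finset.univ : Finset (Fin n)) ∧ k ∈ F then D' i k ∪ E
      else D' i k) = D₁ := by
    funext i k; simp [hD₁]
  have e3 : (fun i k => if i ∈ (∅ : Finset (Fin n)) ∧ k ∈ F then D' i k ∪ E
      else D' i k) = D' := by
    funext i k; simp
  rw [e1, Finset.coe_univ, Finset.card_univ, Fintype.card_fin] at h1
  rw [e2, e3, Finset.card_univ, Fintype.card_fin] at h2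
  refine ((h1.trans h2).trans h3).mono (le_of_eq ?_)
  ring

open Classical in
/-- Tiled multiplication with tiles of at most `a × b` entries. -/
theorem reach_multiplication [Fintype J] (hn : 1 ≤ n) (hYf : ∀ v ∈ Y, v.IsFactor)
    (hQ : ∀ i k, .Q i k ∈ Y) (hK : ∀ i k, .K i k ∈ Y) (hV : ∀ i k, .V i k ∈ Y)
    (hY : ∀ e : J, ¬ Evaluable s e → ∀ i, .U₁ i e ∈ Y ∧ .U₂ i e ∈ Y) {a b z p q : ℕ}
    (hM : a * b + s.card + b + 2 ≤ M)
    (hz : ∀ E : Finset J, E.card ≤ a → (E.filter fun e => ¬ Evaluable s e).card ≤ z)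
    (hp : Fintype.card J ≤ p * a) (hq : d ≤ q * b) :
    Reach (dag n d J) M (config ∅ (fun _ _ => ∅) (fun _ _ => ∅) Y (fun _ _ => ∅))
      (config ∅ (fun _ _ => ∅) (fun _ _ => ∅) Y (fun _ _ => Set.univ))
      (q * (p * (n * (2 * s.card + 3 * b + 2 * z)))) := by
  have key := Reach.loop_blocks (G := dag n d J) (M := M) (Finset.univ : Finset (Fin d))
    (fun F => config ∅ (fun _ _ => ∅) (fun _ _ => ∅) Y (fun _ k => if k ∈ F then Set.univ else ∅))
    b (p * (n * (2 * s.card + 3 * b + 2 * z))) q (by simpa using hq) ?_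
  · simpa using key
  intro F₀ F hdF hFb
  -- For a fixed block `F` of output columns the blocks of monomials follow one another; the outputs
  -- in `F₀` are complete, those in `F` have received `E`.
  have key := Reach.loop_blocks (G := dag n d J) (M := M) (Finset.univ : Finset J)
    (fun E => config ∅ (fun _ _ => ∅) (fun _ _ => ∅) Y
      (fun _ k => if k ∈ F₀ then Set.univ else if k ∈ F then E else ∅))
    a (n * (2 * s.card + 3 * b + 2 * z)) p (by simpa using hp) ?_
  · have e1 : (fun (_ : Fin n) k => if k ∈ F₀ then Set.univ else if k ∈ F then
        ((∅ : Finset J) : Set J) else ∅) = fun _ k => if k ∈ F₀ then Set.univ else ∅ := by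
      funext i k; simp
    have e2 : (fun (_ : Fin n) k => if k ∈ F₀ then Set.univ else if k ∈ F then
        ((Finset.univ : Finset J) : Set J) else ∅) =
        fun _ k => if k ∈ F₀ ∪ F then Set.univ else ∅ := by
      funext i k
      by_cases h1 : k ∈ F₀ <;> by_cases h2 : k ∈ F <;> simp [h1, h2]
    rw [e1, e2] at key
    exact key
  intro E₀ E hdE hEa
  have hkF : ∀ k ∈ F, k ∉ F₀ := fun k hk hk₀ => Finset.disjoint_left.1 hdF hk₀ hk
  refine (reach_tile (s := s) (E := E) (F := F) hn hYf hQ hK hV (fun e _ h => hY e h) ?_ ?_ ?_).mono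
    ?_
  · have := Nat.mul_le_mul hEa hFb
    omega
  · intro i k hk
    simp only [hkF k hk, hk, if_false, if_true]
    exact_mod_cast hdE
  · intro i k
    by_cases hk : k ∈ F
    · simp [hkF k hk, hk]
    · simp [hk]
  · refine Nat.mul_le_mul_left _ ?_
    have := hz E hEa
    omega

end ApproxAttention

/-! ### Start, end, and precomputation of `U₁` and `U₂` -/

namespace ApproxAttention

open Pebbling

variable {n d : ℕ} {J : Set (Fin d → ℕ)} {M : ℕ}

/-- The nodes without parents. -/
def sources (n d : ℕ) (J : Set (Fin d → ℕ)) : Set (Node n d J) :=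
  {v | ∀ u, ¬ (dag n d J).Adj u v}

/-- The sources, and the entries of `U₁` and `U₂` whose row and column form a pair in `S`. -/
def computedFactors (S : Finset (Fin n × J)) : Set (Node n d J) :=
  sources n d J ∪ {v | ∃ x ∈ S, v = .U₁ x.1 x.2 ∨ v = .U₂ x.1 x.2}

theorem isFactor_of_mem_sources (hn : 1 ≤ n) (e₀ : J) {v : Node n d J} (hv : v ∈ sources n d J) :
    v.IsFactor := by
  cases v with
  | prodH i e k => exact hv _ (Edge.U₂_prodH i e k)
  | H e k => exact hv _ (Edge.prodH_H ⟨0, hn⟩ e k)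
  | prodO i e k => exact hv _ (Edge.U₁_prodO i e k)
  | O i k => exact hv _ (Edge.prodO_O i e₀ k)
  | _ => trivial

theorem isFactor_of_mem_computedFactors (hn : 1 ≤ n) (e₀ : J) {S : Finset (Fin n × J)}
    {v : Node n d J} (hv : v ∈ computedFactors S) : v.IsFactor := by
  rcases hv with hv | ⟨x, -, rfl | rfl⟩
  · exact isFactor_of_mem_sources hn e₀ hv
  · trivial
  · trivial

theorem Q_mem_computedFactors (S : Finset (Fin n × J)) (i : Fin n) (k : Fin d) :
    .Q i k ∈ computedFactors S := Or.inl fun _ h => by cases h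

theorem K_mem_computedFactors (S : Finset (Fin n × J)) (i : Fin n) (k : Fin d) :
    .K i k ∈ computedFactors S := Or.inl fun _ h => by cases h

theorem V_mem_computedFactors (S : Finset (Fin n × J)) (i : Fin n) (k : Fin d) :
    .V i k ∈ computedFactors S := Or.inl fun _ h => by cases h

/-- A source has an empty set of parents, so its initial value `some ∅` is its final value in the
sense of `content`. -/
theorem start_eq_config :
    start (dag n d J) = config ∅ (fun _ _ => ∅) (fun _ _ => ∅) (computedFactors ∅)
      (fun _ _ => ∅) := by
  have hacc : ∀ v : Node n d J, accumulated (fun _ _ => ∅) (fun _ _ => ∅) v = none := by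
    intro v
    cases v <;> simp [accumulated]
  unfold start config
  congr 1
  · funext v
    rw [content_of_notMem (Set.notMem_empty v), hacc]
  · funext v
    by_cases hv : ∀ u, ¬ (dag n d J).Adj u v
    · rw [if_pos hv, content_of_mem (Or.inl hv)]
      congr 1
      ext u
      simpa using hv u
    · rw [if_neg hv, content_of_notMem, hacc]
      rintro (h | ⟨x, hx, -⟩)
      · exact hv h
      · simp at hx

/-- Input entries that no product uses are sinks as well; being sources, they are final from the
start. -/
theorem isFinished_config (hn : 1 ≤ n) (hd : 1 ≤ d) (e₀ : J) (S : Finset (Fin n × J)) :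
    IsFinished (dag n d J) (config ∅ (fun _ _ => ∅) (fun _ _ => ∅) (computedFactors S)
      (fun _ _ => Set.univ)) := by
  intro v hv
  by_cases hvS : v ∈ computedFactors S
  · exact ⟨_, content_of_mem hvS, isFinal_parents _ _⟩
  cases v with
  | Q i k => exact absurd (Q_mem_computedFactors S i k) hvS
  | K i k => exact absurd (K_mem_computedFactors S i k) hvS
  | V i k => exact absurd (V_mem_computedFactors S i k) hvS
  | U₁ i e => exact absurd (Edge.U₁_prodO i e ⟨0, hd⟩) (hv _)
  | U₂ i e => exact absurd (Edge.U₂_prodH i e ⟨0, hd⟩) (hv _)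
  | prodH i e k => exact absurd (Edge.prodH_H i e k) (hv _)
  | H e k => exact absurd (Edge.H_prodO ⟨0, hn⟩ e k) (hv _)
  | prodO i e k => exact absurd (Edge.prodO_O i e k) (hv _)
  | O i k =>
    refine ⟨(fun e => .prodO i e k) '' Set.univ, ?_, ?_⟩
    · have : Nonempty J := ⟨e₀⟩
      rw [← partialValue_of_nonempty (Set.univ_nonempty.image _)]
      exact content_of_notMem hvS
    · intro u hu
      cases hu with | prodO_O i e k => exact ⟨e, trivial, rfl⟩

variable {X Y : Set (Node n d J)} {T : J → Fin d → Set (Fin n)} {D D' : Fin n → Fin d → Set J}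

theorem reach_save_factor {v : Node n d J} (hv : v ∈ X)
    (hcap : (config X T D Y D').redCount ≤ M) :
    Reach (dag n d J) M (config X T D Y D') (config X T D (insert v Y) D') 1 := by
  classical
  have heq : (fun w => if w ∈ ({v} : Finset (Node n d J)) then (config X T D Y D').fast w
      else (config X T D Y D').slow w) = content (insert v Y) (fun _ _ => ∅) D' := by
    funext w
    by_cases hw : w = v
    · subst hw
      rw [if_pos (by simp), content_of_mem (Or.inl rfl)]
      exact content_of_mem hv
    · simp [hw, config, content]
  have h := Reach.save_finset (G := dag n d J) (M := M) (config X T D Y D') {v}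
    (fun w hw => by
      obtain rfl := Finset.mem_singleton.1 hw
      rw [show (config X T D Y D').fast w = _ from content_of_mem hv]
      simp) hcap
  rw [heq, Finset.card_singleton] at h
  exact h

open Classical in
/-- The nodes in `B`, all of whose parents are in `A`, are computed and saved. -/
theorem reach_batch (A B : Finset (Node n d J)) (hA : ∀ v ∈ A, v ∈ Y ∧ v.IsFactor)
    (hB : ∀ v ∈ B, v.IsFactor ∧ v ∉ A ∧ ∃ P : Finset (Node n d J),
      (∀ u, (dag n d J).Adj u v ↔ u ∈ P) ∧ P.Nonempty ∧ P ⊆ A) (hM : A.card + 1 ≤ M) :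
    Reach (dag n d J) M (config ∅ (fun _ _ => ∅) (fun _ _ => ∅) Y (fun _ _ => ∅))
      (config ∅ (fun _ _ => ∅) (fun _ _ => ∅) (Y ∪ B) (fun _ _ => ∅)) (A.card + B.card) := by
  have cap : ∀ X Y : Set (Node n d J), X.encard ≤ M →
      (config X (fun _ _ => ∅) (fun _ _ => ∅) Y (fun _ _ => ∅)).redCount ≤ M := by
    intro X Y hX
    refine (Set.encard_le_encard fun v hv => ?_).trans hX
    by_contra hvX
    refine hv ((content_of_notMem hvX).trans ?_)
    cases v <;> simp [accumulated]
  have hAe : (A : Set (Node n d J)).encard ≤ M := by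
    rw [Set.encard_coe_eq_coe_finsetCard]; exact Nat.cast_le.2 (by omega)
  have hAi : ∀ v, (insert v (A : Set (Node n d J))).encard ≤ M := by
    intro v
    refine (Set.encard_insert_le _ _).trans ?_
    rw [Set.encard_coe_eq_coe_finsetCard]
    exact_mod_cast hM
  have h1 := reach_load_factors (X := ∅) (Y := Y) (T := fun _ _ => ∅) (D := fun _ _ => ∅)
    (D' := fun _ _ => ∅) (M := M) A (fun v hv => (hA v hv).1) (by
      rw [Set.empty_union]; exact cap _ _ hAe)
  rw [Set.empty_union] at h1
  have h2 := Reach.loop_const (G := dag n d J) (M := M) B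
    (fun S => config A (fun _ _ => ∅) (fun _ _ => ∅) (Y ∪ S) (fun _ _ => ∅)) 1 (by
      intro S _ v hv _
      obtain ⟨hvf, hvA, P, hP, hPne, hPA⟩ := hB v hv
      have s1 := reach_compute_factor (X := (A : Set (Node n d J))) (Y := Y ∪ S)
        (T := fun _ _ => ∅) (D := fun _ _ => ∅) (D' := fun _ _ => ∅) hvf (by simpa using hvA) P hP
        hPne (fun u hu => by exact_mod_cast hPA hu) (cap _ _ (hAi v))
      have s2 := reach_save_factor (v := v) (X := insert v (A : Set (Node n d J))) (Y := Y ∪ S)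
        (T := fun _ _ => ∅) (D := fun _ _ => ∅) (D' := fun _ _ => ∅) (Or.inl rfl) (cap _ _ (hAi v))
      have s3 := reach_delete_factors (X := insert v (A : Set (Node n d J)))
        (Y := insert v (Y ∪ S)) (T := fun _ _ => ∅) (D := fun _ _ => ∅) (D' := fun _ _ => ∅) {v}
        (by simpa using hvf) (cap _ _ (hAi v))
      have e1 : insert v (A : Set (Node n d J)) \ (({v} : Finset (Node n d J)) : Set (Node n d J)) =
          A := by
        rw [Finset.coe_singleton]
        exact Set.insert_sdiff_self_of_notMem (by simpa using hvA)
      have e2 : insert v (Y ∪ (S : Set (Node n d J))) = Y ∪ (insert v S : Finset (Node n d J)) := by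
        rw [Finset.coe_insert, Set.union_insert]
      rw [e1, e2] at s3
      rw [e2] at s2
      simpa using (s1.trans s2).trans s3)
  rw [Finset.coe_empty, Set.union_empty] at h2
  have h3 := reach_delete_factors (X := (A : Set (Node n d J))) (Y := Y ∪ B)
    (T := fun _ _ => ∅) (D := fun _ _ => ∅) (D' := fun _ _ => ∅) A (fun v hv => (hA v hv).2)
    (cap _ _ hAe)
  rw [Set.sdiff_self] at h3
  exact ((h1.trans h2).trans h3).mono (by omega)

-- The entries in `s` are loaded once for each of `Q` and `K`; then every entry of `U₁` or `U₂`
-- costs one save.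
open Classical in
theorem reach_factors_of_row (i : Fin n) (E : Finset J) (s : Finset (Fin d))
    (hs : ∀ e ∈ E, ∀ k, e.1 k ≠ 0 → k ∈ s) (hM : s.card + 1 ≤ M) (S : Finset (Fin n × J)) :
    Reach (dag n d J) M
      (config ∅ (fun _ _ => ∅) (fun _ _ => ∅) (computedFactors S) (fun _ _ => ∅))
      (config ∅ (fun _ _ => ∅) (fun _ _ => ∅) (computedFactors (S ∪ {i} ×ˢ E)) (fun _ _ => ∅))
      (2 * (s.card + E.card)) := by
  -- Constant monomials are left out: their nodes are sources and already in slow memory.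
  set E' := E.filter fun e => ∃ k, e.1 k ≠ 0 with hE'
  have hE'c : E'.card ≤ E.card := Finset.card_filter_le _ _
  have h1 := reach_batch (Y := computedFactors S) (M := M) (s.image (.Q i)) (E'.image (.U₁ i))
    (by
      intro v hv
      obtain ⟨k, -, rfl⟩ := Finset.mem_image.1 hv
      exact ⟨Q_mem_computedFactors S i k, trivial⟩)
    (by
      intro v hv
      obtain ⟨e, he, rfl⟩ := Finset.mem_image.1 hv
      obtain ⟨heE, k, hk⟩ := Finset.mem_filter.1 he
      refine ⟨trivial, by simp, (Finset.univ.filter fun k => e.1 k ≠ 0).image (.Q i), ?_, ?_, ?_⟩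
      · intro u
        constructor
        · intro h
          cases h with | Q_U₁ i k e h => exact Finset.mem_image_of_mem _ (by simpa using h)
        · intro h
          obtain ⟨k, hk, rfl⟩ := Finset.mem_image.1 h
          exact Edge.Q_U₁ i k e (by simpa using hk)
      · exact ⟨_, Finset.mem_image_of_mem _ (by simpa using hk)⟩
      · refine Finset.image_subset_image fun k hk => hs e heE k (by simpa using hk))
    ((Nat.add_le_add_right Finset.card_image_le 1).trans hM)
  have h2 := reach_batch (Y := computedFactors S ∪ (E'.image (.U₁ i) : Finset (Node n d J)))
    (M := M) (s.image (.K i)) (E'.image (.U₂ i))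
    (by
      intro v hv
      obtain ⟨k, -, rfl⟩ := Finset.mem_image.1 hv
      exact ⟨Or.inl (K_mem_computedFactors S i k), trivial⟩)
    (by
      intro v hv
      obtain ⟨e, he, rfl⟩ := Finset.mem_image.1 hv
      obtain ⟨heE, k, hk⟩ := Finset.mem_filter.1 he
      refine ⟨trivial, by simp, (Finset.univ.filter fun k => e.1 k ≠ 0).image (.K i), ?_, ?_, ?_⟩
      · intro u
        constructor
        · intro h
          cases h with | K_U₂ i k e h => exact Finset.mem_image_of_mem _ (by simpa using h)
        · intro h
          obtain ⟨k, hk, rfl⟩ := Finset.mem_image.1 h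
          exact Edge.K_U₂ i k e (by simpa using hk)
      · exact ⟨_, Finset.mem_image_of_mem _ (by simpa using hk)⟩
      · refine Finset.image_subset_image fun k hk => hs e heE k (by simpa using hk))
    ((Nat.add_le_add_right Finset.card_image_le 1).trans hM)
  have heq : computedFactors S ∪ (E'.image (.U₁ i) : Finset (Node n d J)) ∪
      (E'.image (.U₂ i) : Finset (Node n d J)) = computedFactors (S ∪ {i} ×ˢ E) := by
    ext v
    constructor
    · rintro (((h | ⟨x, hx, h⟩) | h) | h)
      · exact Or.inl h
      · exact Or.inr ⟨x, Finset.mem_union_left _ hx, h⟩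
      · obtain ⟨e, he, rfl⟩ := Finset.mem_image.1 h
        exact Or.inr ⟨(i, e), Finset.mem_union_right _ (by simpa using (Finset.mem_filter.1 he).1),
          Or.inl rfl⟩
      · obtain ⟨e, he, rfl⟩ := Finset.mem_image.1 h
        exact Or.inr ⟨(i, e), Finset.mem_union_right _ (by simpa using (Finset.mem_filter.1 he).1),
          Or.inr rfl⟩
    · rintro (h | ⟨x, hx, h⟩)
      · exact Or.inl (Or.inl (Or.inl h))
      · rcases Finset.mem_union.1 hx with hx | hx
        · exact Or.inl (Or.inl (Or.inr ⟨x, hx, h⟩))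
        obtain ⟨i', e⟩ := x
        simp only [Finset.mem_product, Finset.mem_singleton] at hx
        obtain ⟨rfl, he⟩ := hx
        by_cases hne : ∃ k, e.1 k ≠ 0
        · have he' : e ∈ E' := Finset.mem_filter.2 ⟨he, hne⟩
          rcases h with rfl | rfl
          · exact Or.inl (Or.inr (Finset.mem_image_of_mem _ he'))
          · exact Or.inr (Finset.mem_image_of_mem _ he')
        · refine Or.inl (Or.inl (Or.inl fun u hu => ?_))
          rcases h with rfl | rfl
          · cases hu with | Q_U₁ i k e h => exact hne ⟨k, h⟩
          · cases hu with | K_U₂ i k e h => exact hne ⟨k, h⟩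
  rw [heq] at h2
  refine (h1.trans h2).mono ?_
  have c1 : (s.image (.Q i) : Finset (Node n d J)).card ≤ s.card := Finset.card_image_le
  have c2 : (s.image (.K i) : Finset (Node n d J)).card ≤ s.card := Finset.card_image_le
  have c3 : (E'.image (.U₁ i) : Finset (Node n d J)).card ≤ E'.card := Finset.card_image_le
  have c4 : (E'.image (.U₂ i) : Finset (Node n d J)).card ≤ E'.card := Finset.card_image_le
  omega

theorem reach_all_factors_by_rows [Fintype J] (hM : d + 1 ≤ M) :
    Reach (dag n d J) M (start (dag n d J))
      (config ∅ (fun _ _ => ∅) (fun _ _ => ∅) (computedFactors Finset.univ) (fun _ _ => ∅))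
      (n * (2 * (d + Fintype.card J))) := by
  classical
  have key := Reach.loop_const (G := dag n d J) (M := M) (Finset.univ : Finset (Fin n))
    (fun R => config ∅ (fun _ _ => ∅) (fun _ _ => ∅) (computedFactors (R ×ˢ Finset.univ))
      (fun _ _ => ∅)) (2 * (d + Fintype.card J)) ?_
  · rw [Finset.empty_product, Finset.univ_product_univ, Finset.card_univ, Fintype.card_fin,
      ← start_eq_config] at key
    exact key
  intro R _ i _ _
  have h := reach_factors_of_row i (Finset.univ : Finset J) Finset.univ (fun _ _ k _ => by simp)
    (by simpa using hM) (R ×ˢ Finset.univ)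
  rw [← Finset.union_product, Finset.union_comm, ← Finset.insert_eq] at h
  simpa using h

/-- For rows that do not fit into fast memory: a monomial of degree at most `g` needs only `g`
entries of its row. -/
theorem reach_all_factors_one_by_one [Fintype J] {g : ℕ} (hJ : J ⊆ monomials d g)
    (hM : g + 1 ≤ M) :
    Reach (dag n d J) M (start (dag n d J))
      (config ∅ (fun _ _ => ∅) (fun _ _ => ∅) (computedFactors Finset.univ) (fun _ _ => ∅))
      (n * Fintype.card J * (2 * (g + 1))) := by
  classical
  have key := Reach.loop_const (G := dag n d J) (M := M) (Finset.univ : Finset (Fin n × J))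
    (fun S => config ∅ (fun _ _ => ∅) (fun _ _ => ∅) (computedFactors S)
      (fun _ _ => ∅)) (2 * (g + 1)) ?_
  · rw [Finset.card_univ, Fintype.card_prod, Fintype.card_fin, ← start_eq_config] at key
    exact key
  rintro S _ ⟨i, e⟩ _ _
  have hc : (Finset.univ.filter fun k => e.1 k ≠ 0).card ≤ g := by
    refine le_trans ?_ (hJ e.2 : ∑ k, e.1 k ≤ g)
    rw [Finset.card_filter]
    exact Finset.sum_le_sum fun k _ => by split_ifs <;> omega
  have h := reach_factors_of_row i {e} (Finset.univ.filter fun k => e.1 k ≠ 0)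
    (fun e' he' k hk => by
      obtain rfl := Finset.mem_singleton.1 he'
      simpa using hk) ((Nat.add_le_add_right hc 1).trans hM) S
  rw [Finset.singleton_product_singleton, Finset.union_comm, ← Finset.insert_eq] at h
  exact h.mono (by rw [Finset.card_singleton]; omega)

/-! ### The upper bound: choice of the tile shape -/

theorem mul_le_rank {d g : ℕ} (hg : 1 ≤ g) : d * g ≤ rank d g := by
  rw [rank_eq_sum]
  have := Finset.single_le_sum (f := fun j => d.choose j * g.choose j)
    (fun _ _ => Nat.zero_le _) (Finset.mem_range.2 (show 1 < g + 1 by omega))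
  simpa using this

/-- A full row fits next to a tile of full width, so nothing is precomputed. There are `O(r * d /
M)` tiles, of cost `O(n * d)` each. -/
theorem cost_le_of_sq_le {g : ℕ} (hn : 1 ≤ n) (hd : 1 ≤ d) (hM : 64 ≤ M)
    (hMr : M ≤ d * rank d g) (hdM : d ^ 2 ≤ M) :
    ∃ k : ℕ, cost n d g M ≤ k ∧ k * M ≤ 112 * (n * rank d g * d ^ 2) := by
  classical
  have := (finite_monomials d g).fintype
  have hcard : Fintype.card (monomials d g) = rank d g := by
    rw [← ncard_monomials, ← Nat.card_coe_set_eq, Nat.card_eq_fintype_card]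
  set r := rank d g with hr
  have h8 : 8 * d ≤ M := by
    rcases le_total d 8 with h | h
    · omega
    · nlinarith
  -- The tile takes at most `M / 4`, and the row data `2 * d ≤ M / 4`; rounding down loses at most a
  -- factor of two, so `M ≤ 8 * d * a`.
  set a := M / (4 * d) with ha
  have hpos : 0 < 4 * d := by omega
  have ha1 : 1 ≤ a := (Nat.one_le_div_iff hpos).2 (by omega)
  have haM : a * (4 * d) ≤ M := Nat.div_mul_le_self _ _
  have hMa : M ≤ 8 * d * a := by
    have := Nat.lt_div_mul_add hpos (a := M)
    rw [← ha] at this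
    nlinarith
  have har : a ≤ r := by
    have : a * (4 * d) ≤ r * d := haM.trans (by rw [mul_comm]; exact hMr)
    have : a * d ≤ r * d := by nlinarith
    exact Nat.le_of_mul_le_mul_right this hd
  set p := r / a + 1 with hp
  have hpa : r ≤ p * a := by
    have := Nat.lt_div_mul_add (a := r) (b := a) ha1
    rw [hp, add_mul, one_mul]; exact this.le
  have hpa' : p * a ≤ 2 * r := by
    have := Nat.div_mul_le_self r a
    rw [hp, add_mul, one_mul]; omega
  let e₀ : monomials d g := ⟨0, by simp [monomials]⟩
  have key := reach_multiplication (J := monomials d g) (Y := computedFactors ∅) (M := M)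
    (s := Finset.univ) (a := a) (b := d) (z := 1) (p := p) (q := 1) hn
    (fun v hv => isFactor_of_mem_computedFactors hn e₀ hv) (Q_mem_computedFactors ∅)
    (K_mem_computedFactors ∅) (V_mem_computedFactors ∅)
    (fun e he i => by
      have h0 : ∀ k, ¬ e.1 k ≠ 0 := fun k hk => he ⟨⟨k, hk⟩, fun _ _ => Finset.mem_univ _⟩
      constructor
      · left
        intro u hu
        cases hu with | Q_U₁ i k e h => exact h0 k h
      · left
        intro u hu
        cases hu with | K_U₂ i k e h => exact h0 k h)
    (by
      rw [Finset.card_univ, Fintype.card_fin]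
      have : 4 * (a * d) ≤ M := by linarith
      omega)
    -- With all variables at hand only the constant monomial has to be loaded, hence `z = 1`.
    (fun E _ => by
      rw [Finset.card_le_one]
      have h0 : ∀ e : monomials d g, ¬ Evaluable Finset.univ e → e.1 = 0 := by
        intro e he
        funext k
        by_contra hk
        exact he ⟨⟨k, hk⟩, fun _ _ => Finset.mem_univ _⟩
      intro e he e' he'
      exact Subtype.ext ((h0 e (Finset.mem_filter.1 he).2).trans
        (h0 e' (Finset.mem_filter.1 he').2).symm))
    (by rw [hcard]; exact hpa) (by omega)
  rw [← start_eq_config] at key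
  refine ⟨_, optimalCost_le_of_reach key (isFinished_config hn hd e₀ ∅), ?_⟩
  rw [Finset.card_univ, Fintype.card_fin]
  calc 1 * (p * (n * (2 * d + 3 * d + 2 * 1))) * M
      ≤ 1 * (p * (n * (7 * d))) * (8 * d * a) := by
        refine Nat.mul_le_mul ?_ hMa
        gcongr
        omega
    _ = 56 * (n * d ^ 2) * (p * a) := by ring
    _ ≤ 56 * (n * d ^ 2) * (2 * r) := Nat.mul_le_mul_left _ hpa'
    _ = 112 * (n * r * d ^ 2) := by ring

/-- All factors are loaded (`s = ∅`). There are `O(r * d / M)` square tiles, of cost `O(n * √M)`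
each. -/
theorem cost_le_of_lt_sq {g : ℕ} (hn : 1 ≤ n) (hg : 1 ≤ g) (hM : 64 ≤ M) (hgM : g ^ 2 ≤ M)
    (hdM : M ≤ d ^ 2) :
    ∃ k : ℕ, cost n d g M ≤ k ∧ (k : ℝ) * √(M : ℝ) ≤ 112 * ((n : ℝ) * rank d g * d) := by
  classical
  have := (finite_monomials d g).fintype
  have hcard : Fintype.card (monomials d g) = rank d g := by
    rw [← ncard_monomials, ← Nat.card_coe_set_eq, Nat.card_eq_fintype_card]
  have hd : 1 ≤ d := by
    rcases Nat.eq_zero_or_pos d with rfl | h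
    · simp at hdM; omega
    · exact h
  have hdr : d ≤ rank d g := (Nat.le_mul_of_pos_right d hg).trans (mul_le_rank hg)
  set r := rank d g with hr
  have hsd : Nat.sqrt M ≤ d := by
    have := Nat.sqrt_le_sqrt hdM
    rwa [pow_two, Nat.sqrt_eq] at this
  have hs8 : 8 ≤ Nat.sqrt M := Nat.le_sqrt.2 (by omega)
  have hsM : Nat.sqrt M * Nat.sqrt M ≤ M := Nat.sqrt_le M
  set t := Nat.sqrt M / 2 with ht
  have ht1 : 1 ≤ t := by omega
  have ht2 : 2 * t ≤ Nat.sqrt M := by omega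
  have ht4 : Nat.sqrt M + 1 ≤ 4 * t := by omega
  have hsqrt : √(M : ℝ) ≤ 4 * t := by
    rw [Real.sqrt_le_left (by positivity)]
    have : M < (Nat.sqrt M + 1) * (Nat.sqrt M + 1) := Nat.lt_succ_sqrt M
    have : M ≤ (4 * t) ^ 2 := by nlinarith
    exact_mod_cast this
  have htM : t * t + t + 2 ≤ M := by nlinarith
  have blocks : ∀ x, t ≤ x → x ≤ (x / t + 1) * t ∧ (x / t + 1) * t ≤ 2 * x := by
    intro x hx
    have h1 := Nat.lt_div_mul_add (a := x) (b := t) ht1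
    have h2 := Nat.div_mul_le_self x t
    rw [add_mul, one_mul]
    omega
  obtain ⟨hp, hp'⟩ := blocks r (by omega)
  obtain ⟨hq, hq'⟩ := blocks d (by omega)
  set p := r / t + 1
  set q := d / t + 1
  let e₀ : monomials d g := ⟨0, by simp [monomials]⟩
  -- Precomputation stays within the bound: by rows it costs at most `4 * n * r`, and `√M ≤ d`; if a
  -- row does not fit, then `M ≤ d`, and `2 * (g + 1) ≤ 4 * √M` saves the entry-wise method.
  have hpre : ∃ k₁ : ℕ, (k₁ : ℝ) * √(M : ℝ) ≤ 4 * ((n : ℝ) * r * d) ∧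
      Reach (dag n d (monomials d g)) M (start (dag n d (monomials d g)))
        (config ∅ (fun _ _ => ∅) (fun _ _ => ∅) (computedFactors Finset.univ) (fun _ _ => ∅))
        k₁ := by
    have hsd' : √(M : ℝ) ≤ d := by
      rw [Real.sqrt_le_left (by positivity)]
      exact_mod_cast hdM
    by_cases hdM1 : d + 1 ≤ M
    · refine ⟨_, ?_, reach_all_factors_by_rows hdM1⟩
      rw [hcard]
      have h1 : ((n * (2 * (d + r)) : ℕ) : ℝ) ≤ 4 * (n * r) := by
        exact_mod_cast (by nlinarith : n * (2 * (d + r)) ≤ 4 * (n * r))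
      calc _ ≤ 4 * ((n : ℝ) * r) * d := by gcongr
        _ = _ := by ring
    · have hgM1 : g + 1 ≤ M := by nlinarith
      refine ⟨_, ?_, reach_all_factors_one_by_one subset_rfl hgM1⟩
      rw [hcard]
      have hMd : (M : ℝ) ≤ d := by exact_mod_cast (by omega : M ≤ d)
      have hgs : (g : ℝ) ≤ √(M : ℝ) := Real.le_sqrt_of_sq_le (by exact_mod_cast hgM)
      have h1 : ((n * r * (2 * (g + 1)) : ℕ) : ℝ) ≤ 4 * (n * r) * √(M : ℝ) := by
        push_cast
        have h2 : (1 : ℝ) ≤ g := by exact_mod_cast hg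
        have h3 : (2 : ℝ) * (g + 1) ≤ 4 * √(M : ℝ) := by linarith
        calc (n : ℝ) * r * (2 * (g + 1)) ≤ n * r * (4 * √(M : ℝ)) := by gcongr
          _ = _ := by ring
      calc _ ≤ 4 * (n * r) * √(M : ℝ) * √(M : ℝ) := by gcongr
        _ = 4 * ((n : ℝ) * r) * M := by
            rw [mul_assoc, Real.mul_self_sqrt (by positivity)]
        _ ≤ 4 * ((n : ℝ) * r) * d := by gcongr
        _ = _ := by ring
  obtain ⟨k₁, hk₁, hr₁⟩ := hpre
  have key := reach_multiplication (J := monomials d g) (Y := computedFactors Finset.univ) (M := M)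
    (s := ∅) (a := t) (b := t) (z := t) (p := p) (q := q) hn
    (fun v hv => isFactor_of_mem_computedFactors hn e₀ hv) (Q_mem_computedFactors _)
    (K_mem_computedFactors _) (V_mem_computedFactors _)
    (fun e _ i => ⟨Or.inr ⟨(i, e), Finset.mem_univ _, Or.inl rfl⟩,
      Or.inr ⟨(i, e), Finset.mem_univ _, Or.inr rfl⟩⟩)
    (by rw [Finset.card_empty]; omega) (fun E hE => (Finset.card_filter_le _ _).trans hE)
    (by rw [hcard]; exact hp) hq
  refine ⟨_, optimalCost_le_of_reach (hr₁.trans key) (isFinished_config hn hd e₀ _), ?_⟩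
  have h2 : ((q * (p * (n * (2 * (∅ : Finset (Fin d)).card + 3 * t + 2 * t))) : ℕ) : ℝ) *
      √(M : ℝ) ≤ 80 * ((n : ℝ) * r * d) := by
    calc _ ≤ ((q * (p * (n * (2 * (∅ : Finset (Fin d)).card + 3 * t + 2 * t))) : ℕ) : ℝ) *
          (4 * t) := by gcongr
      _ = ((20 * n * ((p * t) * (q * t)) : ℕ) : ℝ) := by
          rw [Finset.card_empty]; push_cast; ring
      _ ≤ ((20 * n * ((2 * r) * (2 * d)) : ℕ) : ℝ) := by
          exact_mod_cast Nat.mul_le_mul_left _ (Nat.mul_le_mul hp' hq')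
      _ = _ := by push_cast; ring
  have h3 : (0 : ℝ) ≤ (n : ℝ) * r * d := by positivity
  rw [Nat.cast_add, add_mul]
  linarith

/-- Without rows there are no edges, so every node is a source and the game is finished at the
start. -/
theorem cost_zero_rows (d g M : ℕ) : cost 0 d g M = 0 := by
  refine le_antisymm ?_ zero_le
  refine optimalCost_le_of_reach (k := 0) (Reach.refl _) fun v _ => ⟨∅, if_pos ?_, ?_⟩
  all_goals
    intro u hu
    cases hu <;> exact Fin.elim0 ‹Fin 0›

theorem cost_le {n d g M : ℕ} (hd : 1 ≤ d) (hg : 1 ≤ g) (hM : 64 ≤ M) (hgM : g ^ 2 ≤ M)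
    (hMr : M ≤ d * rank d g) :
    ((cost n d g M : ℕ∞) : ℝ≥0∞) ≤
      ENNReal.ofReal (112 * min ((n : ℝ) * rank d g * (d : ℝ) ^ 2 / M)
        ((n : ℝ) * rank d g * d / √(M : ℝ))) := by
  rcases Nat.eq_zero_or_pos n with rfl | hn
  · simp [cost_zero_rows]
  have hM0 : (0 : ℝ) < M := by exact_mod_cast (by omega : 0 < M)
  have hs0 : 0 < √(M : ℝ) := Real.sqrt_pos.2 hM0
  have hss : √(M : ℝ) * √(M : ℝ) = M := Real.mul_self_sqrt hM0.le
  have hd0 : (0 : ℝ) ≤ d := Nat.cast_nonneg d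
  suffices H : ∃ k : ℕ, cost n d g M ≤ k ∧
      (k : ℝ) ≤ 112 * min ((n : ℝ) * rank d g * (d : ℝ) ^ 2 / M)
        ((n : ℝ) * rank d g * d / √(M : ℝ)) by
    obtain ⟨k, hk, hk'⟩ := H
    calc ((cost n d g M : ℕ∞) : ℝ≥0∞) ≤ ((k : ℕ∞) : ℝ≥0∞) := by exact_mod_cast hk
      _ = ENNReal.ofReal (k : ℝ) := by simp
      _ ≤ _ := ENNReal.ofReal_le_ofReal hk'
  -- The two bounds differ by the factor `d / √M`, so comparing `d ^ 2` with `M` decides which one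
  -- is the minimum.
  have hx : (n : ℝ) * rank d g * (d : ℝ) ^ 2 / M =
      (n : ℝ) * rank d g * d / √(M : ℝ) * (d / √(M : ℝ)) := by
    rw [div_mul_div_comm, hss]; ring
  rcases le_total (d ^ 2) M with h | h
  · obtain ⟨k, hk, hk'⟩ := cost_le_of_sq_le hn hd hM hMr h
    refine ⟨k, hk, ?_⟩
    rw [min_eq_left, mul_div_assoc', le_div_iff₀ hM0]
    · exact_mod_cast hk'
    · rw [hx]
      refine mul_le_of_le_one_right (by positivity) ((div_le_one hs0).2 ?_)
      exact Real.le_sqrt_of_sq_le (by exact_mod_cast h)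
  · obtain ⟨k, hk, hk'⟩ := cost_le_of_lt_sq hn hg hM hgM h
    refine ⟨k, hk, ?_⟩
    rw [min_eq_right, mul_div_assoc', le_div_iff₀ hs0]
    · exact hk'
    · rw [hx]
      refine le_mul_of_one_le_right (by positivity) ((one_le_div hs0).2 ?_)
      rw [Real.sqrt_le_left hd0]
      exact_mod_cast h

end ApproxAttention

/-! ### Absolute constants and the asymptotic hypotheses -/

theorem theorem3 :
    ∃ C > (0 : ℝ), ∃ c > (0 : ℝ), ∃ δ > (0 : ℝ),
      ∀ (ι : Type*) (l : Filter ι) (n d g M r : ι → ℕ),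
        (∀ i, r i = ApproxAttention.rank (d i) (g i)) →
        (∀ᶠ i in l, 1 ≤ g i) →
        ((fun i => (M i : ℝ)) =o[l] fun i => (d i : ℝ) * r i) →
        ((fun i => Real.log (M i)) =O[l] fun i => (g i : ℝ)) →
        ((fun i => (g i : ℝ)) =o[l] fun i => √(M i : ℝ)) →
        ∀ᶠ i in l,
          ((ApproxAttention.cost (n i) (d i) (g i) (M i) : ℕ∞) : ℝ≥0∞) ≤
            ENNReal.ofReal (C * min ((n i : ℝ) * r i * (d i : ℝ) ^ 2 / M i)
              ((n i : ℝ) * r i * d i / √(M i : ℝ))) ∧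
          (5 * g i ≤ d i →
            δ * r i ≤ ((ApproxAttention.richMonomials (d i) (g i)).ncard : ℝ) ∧
            (r i ≤ n i →
              ENNReal.ofReal (c * ((n i : ℝ) * r i * d i * g i / M i)) ≤
                ((ApproxAttention.cost (n i) (d i) (g i) (M i) : ℕ∞) : ℝ≥0∞) ∧
              ENNReal.ofReal (c * ((n i : ℝ) * r i * d i * g i / M i)) ≤
                ((ApproxAttention.richCost (n i) (d i) (g i) (M i) : ℕ∞) : ℝ≥0∞))) := by
  refine ⟨112, by norm_num, 1 / 124, by norm_num, 1 / 2, by norm_num, ?_⟩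
  intro ι l n d g M r hr hg hM _ hgM
  -- The factor `1 / 124` provides `124 * M ≤ d * r` for the lower bound; `1 / 8` provides `(8 * g)
  -- ^ 2 ≤ M`, hence `64 ≤ M` and `g ^ 2 ≤ M`.
  filter_upwards [hg, hM.def (by norm_num : (0 : ℝ) < 1 / 124),
    hgM.def (by norm_num : (0 : ℝ) < 1 / 8)] with i hg hM hgM
  rw [hr i] at hM ⊢
  rw [Real.norm_of_nonneg (by positivity), Real.norm_of_nonneg (by positivity)] at hM hgM
  have hg1 : (1 : ℝ) ≤ g i := by exact_mod_cast hg
  have h8 : 8 * (g i : ℝ) ≤ √(M i : ℝ) := by linarith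
  have hsq : (8 * (g i : ℝ)) ^ 2 ≤ M i := (Real.le_sqrt' (by positivity)).1 h8
  have hsq' : (8 * g i) ^ 2 ≤ M i := by exact_mod_cast hsq
  have hM64 : 64 ≤ M i := by nlinarith
  have hgM' : g i ^ 2 ≤ M i := by nlinarith
  have hMr : 124 * M i ≤ d i * ApproxAttention.rank (d i) (g i) := by
    have : (124 : ℝ) * M i ≤ d i * ApproxAttention.rank (d i) (g i) := by linarith
    exact_mod_cast this
  have hd : 1 ≤ d i := by
    rcases Nat.eq_zero_or_pos (d i) with h | h
    · rw [h, zero_mul] at hMr; omega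
    · exact h
  refine ⟨ApproxAttention.cost_le hd hg hM64 hgM' (by omega), fun hdg => ⟨?_, fun hn => ⟨?_, ?_⟩⟩⟩
  · have := ApproxAttention.rank_le_two_mul_ncard_richMonomials (d := d i) (g := g i) (by omega)
    have : (ApproxAttention.rank (d i) (g i) : ℝ) ≤
        2 * (ApproxAttention.richMonomials (d i) (g i)).ncard := by exact_mod_cast this
    linarith
  · exact ApproxAttention.le_optimalCost_dag (fun _ h => h.1) hdg hg hgM' hMr hn
  · exact ApproxAttention.le_optimalCost_dag subset_rfl hdg hg hgM' hMr hn
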